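/- All spaces are $\Delta$-generated, $k_\Delta$ denotes $\Delta$-kelleyfication (the coreflection of topological spaces onto $\Delta$-generated spaces), and products of spaces are taken in the category of $\Delta$-generated spaces. A \emph{precubical set} $K$ is a presheaf of sets on the box category $\square$, the subcategory of sets with objects $[n]=\{0,1\}^n$ ($n\ge 0$) generated by the coface maps $\delta_i^{\alpha}:[n-1]\to[n]$ inserting $\alpha\in\{0,1\}$ at place $i$; $K_n=K([n])$ is the set of $n$-cubes. A \emph{multipointed $d$-space} $X$ is a space $|X|$ with a subset $X^0$ of states and a set of continuous paths $[0,1]\to|X|$ between states, the execution paths, closed under reparametrization by the group $\mathcal G(1,1)$ of nondecreasing homeomorphisms of $[0,1]$ and under normalized composition $*_N$ (each of the two paths is run in time $1/2$). Maps are the continuous maps preserving states and execution paths. $\mathbb P^{top}_{\alpha,\beta}X$ is the set of execution paths from $\alpha$ to $\beta$ with the topology $k_\Delta$ of the relative compact-open topology. A \emph{flow} is a small semicategory (category without identities) enriched over $\Delta$-generated spaces; maps of flows are the enriched semifunctors. \emph{Categorization.} For a multipointed $d$-space $X$, the flow $\mathrm{Cat}(X)$ has set of states $X^0$; its space of execution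 paths from $\alpha$ to $\beta$ is the quotient of $\mathbb P^{top}_{\alpha,\beta}X$ that identifies $c$ with $c\phi$ for all $\phi\in\mathcal G(1,1)$; composition is induced by $*_N$. This is a functor from multipointed $d$-spaces to flows. \emph{Tame regular realization.} The regular $n$-cube has underlying space $[0,1]^n$ and set of states $\{0,1\}^n$; its execution paths from $a$ to $b$ are, if $a<b$ (product order), the continuous paths from $a$ to $b$ that are nondecreasing in each coordinate and regular (without stop interval, i.e. without maximal nondegenerate interval on which the path is constant), and there are none if $a\not<b$. The regular cubes form a functor from $\square$ to multipointed $d$-spaces, the coface maps acting by insertion of a coordinate $0$ or $1$. Put $|K|^t_{reg}=\varinjlim_{\square[n]\to K}|\square[n]|^t_{reg}$, the colimit in multipointed $d$-spaces, over all cubes of $K$, of the regular cubes. Its underlying space is the geometric realization $|K|_{geom}=\varinjlim_{\square[n]\to K}[0,1]^n$. \emph{Tame concrete realization.} A $d$-path of $K$ is a finite Moore composition of paths $|c|_{geom}\circ\delta$, where $c\in K_n$ is a cube and $\delta:[0,\ell]\to[0,1]^n$ is continuous and nondecreasing in each coordinate; its $L_1$-arc length is the sum over the pieces of $\sum_i|\delta_i(\ell)-\delta_i(0)|$.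 For $\alpha,\beta\in K_0$ and an integer $n\ge1$, let $\vec N^n_{\alpha,\beta}(K)$ be the set of paths $\gamma:[0,n]\to|K|_{geom}$ of the form $\gamma(t)=p(t/n)$ with $p$ an execution path of $|K|^t_{reg}$ from $\alpha$ to $\beta$, such that for every $t\in[0,n]$ the $L_1$-arc length of $\gamma|_{[0,t]}$ is $t$; it carries the topology $k_\Delta$ of the relative compact-open topology. The flow $|K|_{tc}$ has set of states $K_0$, spaces of execution paths $\mathbb P_{\alpha,\beta}|K|_{tc}=\coprod_{n\ge1}\vec N^n_{\alpha,\beta}(K)$, and composition induced by the Moore composition (concatenation with addition of lengths). \textbf{Proposition.} There is an isomorphism of flows $\mathrm{Cat}(|K|^t_{reg})\cong|K|_{tc}$ for every precubical set $K$, natural in $K$; that is, the functors $K\mapsto\mathrm{Cat}(|K|^t_{reg})$ and $K\mapsto|K|_{tc}$ from precubical sets to flows are naturally isomorphic. -/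

import Mathlib

open CategoryTheory CategoryTheory.Limits Topology
open scoped unitInterval

universe u

noncomputable section

namespace DirectedSpace

/-! ## Delta-generated spaces -/

/-- `g` is continuous for the `Δ`-kelleyfications of the topologies of `Y` and `Z`
(see `Topology.continuousGeneratedBy_iff`). Applied to `Y = A × B` with the product topology this
is continuity on the product of `A` and `B` in the category of `Δ`-generated spaces. -/
abbrev DeltaContinuous {Y Z : Type*} [TopologicalSpace Y] [TopologicalSpace Z] (g : Y → Z) :
    Prop :=
  ContinuousGeneratedBy (fun n : ℕ ↦ Fin n → ℝ) g

instance deltaGenerated_prod (i j : ℕ) : DeltaGeneratedSpace ((Fin i → ℝ) × (Fin j → ℝ)) :=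
  (((Homeomorph.piCongrLeft (Y := fun _ ↦ ℝ) finSumFinEquiv).symm.trans
    Homeomorph.sumArrowHomeomorphProdArrow).isQuotientMap).isGeneratedBy

instance deltaGenerated_cube (n : ℕ) : DeltaGeneratedSpace (ULift.{u} (Fin n → I)) := by
  have h : IsQuotientMap
      (fun x : Fin n → ℝ ↦ (ULift.up (fun i ↦ Set.projIcc 0 1 zero_le_one (x i)) :
        ULift.{u} (Fin n → I))) := by
    refine IsQuotientMap.of_inverse (f := fun (y : ULift.{u} (Fin n → I)) i ↦ (y.down i : ℝ)) ?_ ?_ ?_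
    · exact continuous_pi fun i ↦ continuous_subtype_val.comp
        ((continuous_apply i).comp continuous_uliftDown)
    · refine continuous_uliftUp.comp ?_
      exact continuous_pi fun i ↦ continuous_projIcc.comp (continuous_apply i)
    · intro y
      ext i
      simp
  exact h.isGeneratedBy

theorem DeltaContinuous.continuous {Y Z : Type*} [TopologicalSpace Y] [TopologicalSpace Z]
    [DeltaGeneratedSpace Y] {g : Y → Z} (hg : DeltaContinuous g) : Continuous g :=
  (IsGeneratedBy.continuous_iff (fun n : ℕ ↦ Fin n → ℝ) g).2 hg

/-- Descent of `Δ`-continuity along a quotient map in the second variable. -/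
theorem DeltaContinuous.descend_right {A B B' C : Type*} [TopologicalSpace A] [TopologicalSpace B]
    [TopologicalSpace B'] [TopologicalSpace C] [DeltaGeneratedSpace B] {q : B → B'}
    (hq : IsQuotientMap q) {g : A × B' → C}
    (hg : DeltaContinuous (fun p : A × B ↦ g (p.1, q p.2))) : DeltaContinuous g := by
  let G : ContinuousMapGeneratedBy (fun n : ℕ ↦ Fin n → ℝ) (A × B) C := ⟨_, hg⟩
  have hs : ∀ b', DeltaContinuous (fun a : A ↦ g (a, b')) := by
    intro b'
    obtain ⟨b, rfl⟩ := hq.surjective b'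
    exact (ContinuousMapGeneratedBy.curryEquiv G b).prop
  let H : B' → ContinuousMapGeneratedBy (fun n : ℕ ↦ Fin n → ℝ) A C := fun b' ↦ ⟨_, hs b'⟩
  have hH : DeltaContinuous H := by
    have h1 : DeltaContinuous (H ∘ q) := (ContinuousMapGeneratedBy.curryEquiv G).prop
    have h2 : Continuous (H ∘ q) := DeltaContinuous.continuous h1
    exact ((hq.continuous_iff).2 h2).continuousGeneratedBy
  exact (ContinuousMapGeneratedBy.curryEquiv.symm ⟨H, hH⟩).prop

theorem DeltaContinuous.descend {A A' B B' C : Type*} [TopologicalSpace A] [TopologicalSpace A']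
    [TopologicalSpace B] [TopologicalSpace B'] [TopologicalSpace C] [DeltaGeneratedSpace A]
    [DeltaGeneratedSpace B] {p : A → A'} (hp : IsQuotientMap p) {q : B → B'}
    (hq : IsQuotientMap q) {g : A' × B' → C}
    (hg : DeltaContinuous (fun x : A × B ↦ g (p x.1, q x.2))) : DeltaContinuous g := by
  refine DeltaContinuous.descend_right hq ?_
  have h1 : DeltaContinuous (fun x : B × A ↦ g (p x.2, q x.1)) :=
    ContinuousGeneratedBy.comp hg continuous_swap.continuousGeneratedBy
  have h2 : DeltaContinuous (fun x : B × A' ↦ g (x.2, q x.1)) :=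
    DeltaContinuous.descend_right (g := fun x : B × A' ↦ g (x.2, q x.1)) hp h1
  exact ContinuousGeneratedBy.comp h2 continuous_swap.continuousGeneratedBy

/-! ## Regular paths and reparametrizations -/

section Paths

variable {X : Type*} [TopologicalSpace X]

/-- The path is constant on the interval `[a, b]`. -/
def ConstantOn (γ : I → X) (a b : I) : Prop := ∀ s ∈ Set.Icc a b, ∀ t ∈ Set.Icc a b, γ s = γ t

/-- A stop interval: a nondegenerate interval on which the path is constant, maximal for this
property. -/
def IsStopInterval (γ : I → X) (a b : I) : Prop :=
  a < b ∧ ConstantOn γ a b ∧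
    ∀ a' b' : I, a' ≤ a → b ≤ b' → ConstantOn γ a' b' → a' = a ∧ b' = b

/-- A path is regular if it has no stop interval. -/
def IsRegular (γ : I → X) : Prop := ∀ a b : I, ¬ IsStopInterval γ a b

theorem isRegular_iff [T1Space X] {γ : I → X} (hγ : Continuous γ) :
    IsRegular γ ↔ ∀ a b : I, a < b → ¬ ConstantOn γ a b := by
  refine ⟨fun h a b hab hc ↦ ?_, fun h a b hs ↦ h a b hs.1 hs.2.1⟩
  have ha : a ∈ Set.Icc a b := ⟨le_rfl, hab.le⟩
  have key : ∀ s t : I, s ≤ a → b ≤ t → (ConstantOn γ s t ↔ ∀ r ∈ Set.Icc s t, γ r = γ a) := by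
    intro s t hs ht
    refine ⟨fun hh r hr ↦ hh r hr a ⟨hs, hab.le.trans ht⟩, fun hh r hr r' hr' ↦ ?_⟩
    rw [hh r hr, hh r' hr']
  have hcl : IsClosed (γ ⁻¹' {γ a}) := isClosed_singleton.preimage hγ
  let A : Set I := {s | s ≤ a ∧ ∀ r ∈ Set.Icc s a, γ r = γ a}
  let B : Set I := {t | b ≤ t ∧ ∀ r ∈ Set.Icc b t, γ r = γ a}
  have hmid : ∀ r ∈ Set.Icc a b, γ r = γ a := fun r hr ↦ hc r hr a ha
  have haA : a ∈ A := ⟨le_rfl, fun r hr ↦ by rw [le_antisymm hr.2 hr.1]⟩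
  have hbB : b ∈ B := ⟨le_rfl, fun r hr ↦ by
    rw [le_antisymm hr.2 hr.1]; exact hmid b ⟨hab.le, le_rfl⟩⟩
  let a₀ := sInf A
  let b₀ := sSup B
  have ha₀ : a₀ ≤ a := sInf_le haA
  have hb₀ : b ≤ b₀ := le_sSup hbB
  have h1 : ∀ r, a₀ < r → r ≤ a → γ r = γ a := by
    intro r hr hra
    obtain ⟨s, hs, hsr⟩ := sInf_lt_iff.1 hr
    exact hs.2 r ⟨hsr.le, hra⟩
  have h2 : ∀ r, r < b₀ → b ≤ r → γ r = γ a := by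
    intro r hr hrb
    obtain ⟨s, hs, hsr⟩ := lt_sSup_iff.1 hr
    exact hs.2 r ⟨hrb, hsr.le⟩
  have h3 : ∀ r ∈ Set.Ioo a₀ b₀, γ r = γ a := by
    intro r hr
    rcases le_or_gt r a with h' | h'
    · exact h1 r hr.1 h'
    · rcases le_or_gt r b with h'' | h''
      · exact hmid r ⟨h'.le, h''⟩
      · exact h2 r hr.2 h''.le
  have hlt : a₀ < b₀ := ha₀.trans_lt (hab.trans_le hb₀)
  have h4 : ∀ r ∈ Set.Icc a₀ b₀, γ r = γ a := by
    intro r hr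
    have : closure (Set.Ioo a₀ b₀) ⊆ γ ⁻¹' {γ a} := closure_minimal h3 hcl
    rw [closure_Ioo hlt.ne] at this
    exact this hr
  refine h a₀ b₀ ⟨hlt, (key _ _ ha₀ hb₀).2 h4, fun a' b' ha' hb' hc' ↦ ?_⟩
  have hc'' := (key a' b' (ha'.trans ha₀) (hb₀.trans hb')).1 hc'
  refine ⟨le_antisymm ha' (sInf_le ⟨ha'.trans ha₀, fun r hr ↦ hc'' r ⟨hr.1, ?_⟩⟩),
    le_antisymm (le_sSup ⟨hb₀.trans hb', fun r hr ↦ hc'' r ⟨?_, hr.2⟩⟩) hb'⟩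
  · exact hr.2.trans (hab.le.trans (hb₀.trans hb'))
  · exact (ha'.trans (ha₀.trans hab.le)).trans hr.1

/-- Composition of a path with a nondecreasing homeomorphism of `[0,1]` onto itself. Nondecreasing
homeomorphisms of `[0,1]` and order automorphisms of `[0,1]` are the same thing. -/
def reparam {x y : X} (γ : Path x y) (φ : I ≃o I) : Path x y :=
  γ.reparam φ φ.continuous (OrderIso.map_bot φ) (OrderIso.map_top φ)

@[simp]
theorem reparam_apply {x y : X} (γ : Path x y) (φ : I ≃o I) (t : I) :
    reparam γ φ t = γ (φ t) := rfl

/-- A strictly increasing continuous self-map of `[0,1]` that fixes the end points. -/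
def autOfStrictMono (f : I → I) (hc : Continuous f) (hm : StrictMono f) (h0 : f 0 = 0)
    (h1 : f 1 = 1) : I ≃o I :=
  StrictMono.orderIsoOfSurjective f hm (fun y ↦ by
    have := intermediate_value_Icc (zero_le_one : (0 : I) ≤ 1) hc.continuousOn
    rw [h0, h1] at this
    obtain ⟨x, -, hx⟩ := this ⟨unitInterval.nonneg y, unitInterval.le_one y⟩
    exact ⟨x, hx⟩)

@[simp]
theorem autOfStrictMono_apply (f : I → I) (hc : Continuous f) (hm : StrictMono f) (h0 : f 0 = 0)
    (h1 : f 1 = 1) (t : I) : autOfStrictMono f hc hm h0 h1 t = f t := rfl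

/-- An order automorphism of `[0,1]` from a real function. -/
def autOfReal (f : ℝ → ℝ) (hc : Continuous f) (hm : StrictMonoOn f (Set.Icc 0 1)) (h0 : f 0 = 0)
    (h1 : f 1 = 1) : I ≃o I :=
  autOfStrictMono (fun t ↦ ⟨f t, by
      have h := hm.monotoneOn (Set.left_mem_Icc.2 zero_le_one) t.2 t.2.1
      have h' := hm.monotoneOn t.2 (Set.right_mem_Icc.2 zero_le_one) t.2.2
      rw [h0] at h; rw [h1] at h'; exact ⟨h, h'⟩⟩)
    (by fun_prop) (fun s t hst ↦ hm s.2 t.2 hst) (Subtype.ext h0) (Subtype.ext h1)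

@[simp]
theorem autOfReal_apply (f : ℝ → ℝ) (hc : Continuous f) (hm : StrictMonoOn f (Set.Icc 0 1))
    (h0 : f 0 = 0) (h1 : f 1 = 1) (t : I) : (autOfReal f hc hm h0 h1 t : ℝ) = f t := rfl

theorem trans_reparam {x y z : X} (γ₁ : Path x y) (γ₂ : Path y z) (φ ψ : I ≃o I) :
    ∃ χ : I ≃o I, (reparam γ₁ φ).trans (reparam γ₂ ψ) = reparam (γ₁.trans γ₂) χ := by
  let p : Path (0 : I) 1 := reparam Path.id φ
  let q : Path (0 : I) 1 := reparam Path.id ψ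
  have hp : ∀ t : I, p t = φ t := fun t ↦ rfl
  have hq : ∀ t : I, q t = ψ t := fun t ↦ rfl
  let f : ℝ → ℝ := fun t ↦ if t ≤ 1 / 2 then (p.extend (2 * t) : ℝ) / 2
    else (1 + (q.extend (2 * t - 1) : ℝ)) / 2
  have hf1 : ∀ t : ℝ, (h : t ∈ Set.Icc (0:ℝ) (1/2)) →
      f t = (φ ⟨2 * t, by constructor <;> linarith [h.1, h.2]⟩ : ℝ) / 2 := by
    intro t h
    have : (2 * t) ∈ Set.Icc (0:ℝ) 1 := by constructor <;> linarith [h.1, h.2]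
    simp only [f, if_pos h.2, Path.extend_apply _ this, hp]
  have hf2 : ∀ t : ℝ, (h : t ∈ Set.Ioc (1/2 : ℝ) 1) →
      f t = (1 + (ψ ⟨2 * t - 1, by constructor <;> linarith [h.1, h.2]⟩ : ℝ)) / 2 := by
    intro t h
    have : (2 * t - 1) ∈ Set.Icc (0:ℝ) 1 := by constructor <;> linarith [h.1, h.2]
    simp only [f, if_neg (not_le.2 h.1), Path.extend_apply _ this, hq]
  have hψ0 : ∀ s : I, 0 < (s : ℝ) → 0 < (ψ s : ℝ) := by
    intro s hs
    have : ψ ⊥ < ψ s := ψ.strictMono hs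
    rw [OrderIso.map_bot] at this
    exact this
  have hcont : Continuous f := by
    refine Continuous.if_le ?_ ?_ continuous_id continuous_const ?_
    · fun_prop
    · fun_prop
    · intro t ht
      have ht' : t = 1 / 2 := ht
      subst ht'
      norm_num
  have hmono : StrictMonoOn f (Set.Icc 0 1) := by
    intro s hs t ht hst
    rcases le_or_gt t (1 / 2) with h | h
    · rw [hf1 s ⟨hs.1, hst.le.trans h⟩, hf1 t ⟨ht.1, h⟩]
      have := φ.strictMono (a := ⟨2 * s, by constructor <;> linarith [hs.1]⟩)
        (b := ⟨2 * t, by constructor <;> linarith [ht.1]⟩)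
        (show 2 * s < 2 * t by linarith)
      have h2 := Subtype.coe_lt_coe.2 this
      linarith
    · rw [hf2 t ⟨h, ht.2⟩]
      rcases le_or_gt s (1 / 2) with h' | h'
      · rw [hf1 s ⟨hs.1, h'⟩]
        have h3 := (φ ⟨2 * s, by constructor <;> linarith [hs.1]⟩).2.2
        have h4 := hψ0 ⟨2 * t - 1, by constructor <;> linarith [ht.2]⟩
          (show 0 < 2 * t - 1 by linarith)
        linarith
      · rw [hf2 s ⟨h', hs.2⟩]
        have := ψ.strictMono (a := ⟨2 * s - 1, by constructor <;> linarith [hs.2]⟩)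
          (b := ⟨2 * t - 1, by constructor <;> linarith [ht.2]⟩)
          (show 2 * s - 1 < 2 * t - 1 by linarith)
        have h2 := Subtype.coe_lt_coe.2 this
        linarith
  have h0 : f 0 = 0 := by simp [f]
  have h1 : f 1 = 1 := by
    have : ¬ ((1 : ℝ) ≤ 1 / 2) := by norm_num
    simp only [f, if_neg this]
    norm_num
  refine ⟨autOfReal f hcont hmono h0 h1, ?_⟩
  ext t
  have e : ∀ (r : Path x z) (s : I), r s = r.extend s := fun r s ↦ by simp
  rw [reparam_apply, e, e, autOfReal_apply]
  rcases le_or_gt (t : ℝ) (1 / 2) with h | h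
  · rw [Path.extend_trans_of_le_half _ _ h]
    have ht : (t : ℝ) ∈ Set.Icc (0:ℝ) (1/2) := ⟨t.2.1, h⟩
    have hm : (2 * (t:ℝ)) ∈ Set.Icc (0:ℝ) 1 := by constructor <;> linarith [ht.1, ht.2]
    have hle : f t ≤ 1 / 2 := by
      rw [hf1 _ ht]; linarith [(φ ⟨2 * (t:ℝ), hm⟩).2.2]
    rw [Path.extend_trans_of_le_half _ _ hle, hf1 _ ht, Path.extend_apply _ hm, reparam_apply,
      mul_div_cancel₀ _ (two_ne_zero), Path.extend_extends']
  · rw [Path.extend_trans_of_half_le _ _ h.le]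
    have ht : (t : ℝ) ∈ Set.Ioc (1/2:ℝ) 1 := ⟨h, t.2.2⟩
    have hm : (2 * (t:ℝ) - 1) ∈ Set.Icc (0:ℝ) 1 := by constructor <;> linarith [ht.1, ht.2]
    have hle : 1 / 2 ≤ f t := by
      rw [hf2 _ ht]; linarith [(ψ ⟨2 * (t:ℝ) - 1, hm⟩).2.1]
    rw [Path.extend_trans_of_half_le _ _ hle, hf2 _ ht, Path.extend_apply _ hm, reparam_apply,
      mul_div_cancel₀ _ (two_ne_zero), add_sub_cancel_left, Path.extend_extends']

theorem trans_assoc_reparam {x y z w : X} (γ₁ : Path x y) (γ₂ : Path y z) (γ₃ : Path z w) :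
    ∃ χ : I ≃o I, (γ₁.trans γ₂).trans γ₃ = reparam (γ₁.trans (γ₂.trans γ₃)) χ := by
  let f : ℝ → ℝ := fun t ↦ if t ≤ 1 / 4 then 2 * t else if t ≤ 1 / 2 then t + 1 / 4
    else (t + 1) / 2
  have hcont : Continuous f := by
    refine Continuous.if_le (by fun_prop) (Continuous.if_le (by fun_prop) (by fun_prop)
      (by fun_prop) (by fun_prop) ?_) (by fun_prop) (by fun_prop) ?_
    · intro t ht
      rw [ht]; norm_num
    · intro t ht
      rw [ht]; norm_num
  have hmono : StrictMonoOn f (Set.Icc 0 1) := by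
    intro s _ t _ hst
    simp only [f]
    split_ifs <;> linarith
  refine ⟨autOfReal f hcont hmono (by norm_num [f]) (by norm_num [f]), ?_⟩
  ext t
  have e : ∀ (r : Path x w) (s : I), r s = r.extend s := fun r s ↦ by simp
  rw [reparam_apply, e, e, autOfReal_apply]
  rcases le_or_gt (t : ℝ) (1 / 2) with h | h
  · rw [Path.extend_trans_of_le_half _ _ h]
    rcases le_or_gt (t : ℝ) (1 / 4) with h' | h'
    · have hf : f t = 2 * t := by simp only [f, if_pos h']
      rw [hf, Path.extend_trans_of_le_half _ _ (by linarith),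
        Path.extend_trans_of_le_half _ _ (by linarith)]
    · have hf : f t = t + 1 / 4 := by simp only [f, if_neg (not_le.2 h'), if_pos h]
      rw [hf, Path.extend_trans_of_half_le _ _ (by linarith),
        Path.extend_trans_of_half_le _ _ (by linarith),
        Path.extend_trans_of_le_half _ _ (by linarith)]
      congr 1; ring
  · have h' : ¬ ((t : ℝ) ≤ 1 / 4) := by intro h'; linarith
    have hf : f t = (t + 1) / 2 := by simp only [f, if_neg h', if_neg (not_le.2 h)]
    rw [hf, Path.extend_trans_of_half_le _ _ h.le, Path.extend_trans_of_half_le _ _ (by linarith),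
      Path.extend_trans_of_half_le _ _ (by linarith)]
    congr 1; ring

end Paths

/-! ## The box category and precubical sets -/

/-- The coface map `δ_i^α : {0,1}^n → {0,1}^(n+1)`, which inserts `α` at the place `i`. -/
def coface {n : ℕ} (i : Fin (n + 1)) (α : Bool) (ε : Fin n → Bool) : Fin (n + 1) → Bool :=
  Fin.insertNth (α := fun _ ↦ Bool) i α ε

/-- The maps `{0,1}^m → {0,1}^n` generated under composition by the identities and the coface
maps. -/
inductive IsBoxMap : ∀ {m n : ℕ}, ((Fin m → Bool) → (Fin n → Bool)) → Prop
  | id (n : ℕ) : IsBoxMap (fun ε : Fin n → Bool ↦ ε)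
  | coface {n : ℕ} (i : Fin (n + 1)) (α : Bool) : IsBoxMap (coface i α)
  | comp {l m n : ℕ} {f : (Fin l → Bool) → (Fin m → Bool)} {g : (Fin m → Bool) → (Fin n → Bool)} :
      IsBoxMap f → IsBoxMap g → IsBoxMap (fun ε ↦ g (f ε))

/-- The objects `[n] = {0,1}^n` of the box category. -/
structure Box : Type where
  /-- The dimension `n` of `[n]`. -/
  dim : ℕ

/-- The box category: the subcategory of sets generated by the coface maps. -/
instance : SmallCategory Box where
  Hom a b := {f : (Fin a.dim → Bool) → (Fin b.dim → Bool) // IsBoxMap f}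
  id a := ⟨fun ε ↦ ε, IsBoxMap.id a.dim⟩
  comp f g := ⟨fun ε ↦ g.1 (f.1 ε), IsBoxMap.comp f.2 g.2⟩

/-- Precubical sets: presheaves of sets on the box category. -/
abbrev PrecubicalSet := Boxᵒᵖ ⥤ Type u

/-- The set `K_n` of `n`-cubes. -/
abbrev PrecubicalSet.cubes (K : PrecubicalSet.{u}) (n : ℕ) : Type u := K.obj (Opposite.op ⟨n⟩)

theorem IsBoxMap.coordinate {m n : ℕ} {f : (Fin m → Bool) → (Fin n → Bool)} (hf : IsBoxMap f) :
    ∀ i, (∃ b, ∀ ε, f ε i = b) ∨ ∃ j, ∀ ε, f ε i = ε j := by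
  induction hf with
  | id n => exact fun i ↦ Or.inr ⟨i, fun _ ↦ rfl⟩
  | coface k α =>
    intro i
    refine Fin.succAboveCases k ?_ (fun j ↦ ?_) i
    · exact Or.inl ⟨α, fun ε ↦ by simp [DirectedSpace.coface]⟩
    · exact Or.inr ⟨j, fun ε ↦ by simp [DirectedSpace.coface]⟩
  | comp _ _ ihf ihg =>
    intro i
    rcases ihg i with ⟨b, hb⟩ | ⟨j, hj⟩
    · exact Or.inl ⟨b, fun ε ↦ hb _⟩
    · rcases ihf j with ⟨b, hb⟩ | ⟨k, hk⟩
      · exact Or.inl ⟨b, fun ε ↦ (hj _).trans (hb ε)⟩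
      · exact Or.inr ⟨k, fun ε ↦ (hj _).trans (hk ε)⟩

theorem IsBoxMap.exists_coordinate {m n : ℕ} {f : (Fin m → Bool) → (Fin n → Bool)}
    (hf : IsBoxMap f) : ∀ j, ∃ i, ∀ ε, f ε i = ε j := by
  induction hf with
  | id n => exact fun j ↦ ⟨j, fun _ ↦ rfl⟩
  | coface k α => exact fun j ↦ ⟨k.succAbove j, fun ε ↦ by simp [DirectedSpace.coface]⟩
  | comp _ _ ihf ihg =>
    intro j
    obtain ⟨i, hi⟩ := ihf j
    obtain ⟨k, hk⟩ := ihg i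
    exact ⟨k, fun ε ↦ (hk _).trans (hi ε)⟩

/-- The extension to the topological cubes `[0,1]^m → [0,1]^n` of a map `{0,1}^m → {0,1}^n` of the
box category. Every coordinate of such a map is either constant or a coordinate of the source, and
the lattice polynomial below is this constant or this coordinate: see `cubeMap_coface`,
`cubeMap_id` and `cubeMap_comp`. -/
def cubeMap {m n : ℕ} (f : (Fin m → Bool) → (Fin n → Bool)) (x : Fin m → I) (i : Fin n) : I :=
  (Finset.univ.filter (fun ε ↦ f ε i = true)).sup
    (fun ε ↦ (Finset.univ.filter (fun j ↦ ε j = true)).inf x)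

theorem cubeMap_of_const {m n : ℕ} {f : (Fin m → Bool) → (Fin n → Bool)} {i : Fin n} {b : Bool}
    (h : ∀ ε, f ε i = b) (x : Fin m → I) : cubeMap f x i = if b then 1 else 0 := by
  cases b with
  | false => simp only [cubeMap, h]; simp; rfl
  | true =>
    simp only [cubeMap, h]
    refine top_le_iff.1 ?_
    refine le_trans ?_ (Finset.le_sup (b := fun _ ↦ false) (by simp))
    simp

theorem cubeMap_of_proj {m n : ℕ} {f : (Fin m → Bool) → (Fin n → Bool)} {i : Fin n} {j : Fin m}
    (h : ∀ ε, f ε i = ε j) (x : Fin m → I) : cubeMap f x i = x j := by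
  simp only [cubeMap, h]
  refine le_antisymm (Finset.sup_le fun ε hε ↦ Finset.inf_le (by simpa using hε)) ?_
  refine le_trans ?_ (Finset.le_sup (b := fun k ↦ decide (k = j)) (by simp))
  simp

theorem cubeMap_coface {n : ℕ} (i : Fin (n + 1)) (α : Bool) (x : Fin n → I) :
    cubeMap (coface i α) x = Fin.insertNth (α := fun _ ↦ I) i (if α then 1 else 0) x := by
  funext k
  refine Fin.succAboveCases i ?_ (fun j ↦ ?_) k
  · rw [cubeMap_of_const (b := α) (fun ε ↦ by simp [coface])]; simp
  · rw [cubeMap_of_proj (j := j) (fun ε ↦ by simp [coface])]; simp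

theorem cubeMap_id {n : ℕ} (x : Fin n → I) : cubeMap (fun ε : Fin n → Bool ↦ ε) x = x :=
  funext fun i ↦ cubeMap_of_proj (j := i) (fun _ ↦ rfl) x

theorem cubeMap_comp {l m n : ℕ} (f : (Fin l → Bool) → (Fin m → Bool))
    {g : (Fin m → Bool) → (Fin n → Bool)} (hg : IsBoxMap g) (x : Fin l → I) :
    cubeMap (fun ε ↦ g (f ε)) x = cubeMap g (cubeMap f x) := by
  funext i
  rcases hg.coordinate i with ⟨b, hb⟩ | ⟨j, hj⟩
  · rw [cubeMap_of_const hb, cubeMap_of_const (fun ε ↦ hb _)]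
  · rw [cubeMap_of_proj hj]
    simp only [cubeMap, hj]

theorem IsBoxMap.continuous_cubeMap {m n : ℕ} {f : (Fin m → Bool) → (Fin n → Bool)}
    (hf : IsBoxMap f) : Continuous (cubeMap f) := by
  refine continuous_pi fun i ↦ ?_
  rcases hf.coordinate i with ⟨b, hb⟩ | ⟨j, hj⟩
  · simp only [cubeMap_of_const hb]; fun_prop
  · simp only [cubeMap_of_proj hj]; fun_prop

theorem IsBoxMap.monotone_cubeMap {m n : ℕ} {f : (Fin m → Bool) → (Fin n → Bool)}
    (hf : IsBoxMap f) : Monotone (cubeMap f) := by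
  intro x y hxy i
  rcases hf.coordinate i with ⟨b, hb⟩ | ⟨j, hj⟩
  · simp only [cubeMap_of_const hb]; rfl
  · simp only [cubeMap_of_proj hj]; exact hxy j

theorem IsBoxMap.injective_cubeMap {m n : ℕ} {f : (Fin m → Bool) → (Fin n → Bool)}
    (hf : IsBoxMap f) : Function.Injective (cubeMap f) := by
  intro x y hxy
  funext j
  obtain ⟨i, hi⟩ := hf.exists_coordinate j
  rw [← cubeMap_of_proj hi x, hxy, cubeMap_of_proj hi y]

/-- The vertices `{0,1}^n` of the topological cube `[0,1]^n`. -/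
def IsVertex {n : ℕ} (x : Fin n → I) : Prop := ∀ i, x i = 0 ∨ x i = 1

theorem IsBoxMap.isVertex_cubeMap {m n : ℕ} {f : (Fin m → Bool) → (Fin n → Bool)}
    (hf : IsBoxMap f) {x : Fin m → I} (hx : IsVertex x) : IsVertex (cubeMap f x) := by
  intro i
  rcases hf.coordinate i with ⟨b, hb⟩ | ⟨j, hj⟩
  · rw [cubeMap_of_const hb]; cases b <;> simp
  · rw [cubeMap_of_proj hj]; exact hx j

/-! ## Multipointed `d`-spaces -/

/-- A multipointed `d`-space: a `Δ`-generated space, a subset of states, and a set of continuous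
paths `[0,1] → |X|` between states, called the execution paths, which is closed under
reparametrization by nondecreasing homeomorphisms of `[0,1]` and under normalized composition
(`Path.trans`). -/
structure MdTop : Type (u + 1) where
  /-- The underlying space. -/
  carrier : Type u
  [top : TopologicalSpace carrier]
  [deltaGenerated : DeltaGeneratedSpace carrier]
  /-- The set of states. -/
  states : Set carrier
  /-- The execution paths. -/
  IsExec : ∀ {x y : carrier}, Path x y → Prop
  source_mem : ∀ {x y : carrier} {γ : Path x y}, IsExec γ → x ∈ states
  target_mem : ∀ {x y : carrier} {γ : Path x y}, IsExec γ → y ∈ states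
  reparam_mem : ∀ {x y : carrier} {γ : Path x y} (φ : I ≃o I), IsExec γ → IsExec (reparam γ φ)
  trans_mem : ∀ {x y z : carrier} {γ₁ : Path x y} {γ₂ : Path y z},
    IsExec γ₁ → IsExec γ₂ → IsExec (γ₁.trans γ₂)

namespace MdTop

attribute [instance] top deltaGenerated

/-- A map of multipointed `d`-spaces: a continuous map that takes states to states and execution
paths to execution paths. -/
@[ext]
structure Hom (X Y : MdTop.{u}) where
  /-- The underlying continuous map. -/
  map : C(X.carrier, Y.carrier)
  map_states : ∀ x ∈ X.states, map x ∈ Y.states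
  map_exec : ∀ {x y : X.carrier} {γ : Path x y}, X.IsExec γ → Y.IsExec (γ.map map.continuous)

instance : Category MdTop.{u} where
  Hom := Hom
  id X := ⟨ContinuousMap.id _, fun _ h ↦ h, fun h ↦ h⟩
  comp f g := ⟨g.map.comp f.map, fun x h ↦ g.map_states _ (f.map_states x h),
    fun h ↦ g.map_exec (f.map_exec h)⟩

@[simp]
theorem id_map (X : MdTop.{u}) (x : X.carrier) : Hom.map (𝟙 X) x = x := rfl

@[simp]
theorem comp_map {X Y Z : MdTop.{u}} (f : X ⟶ Y) (g : Y ⟶ Z) (x : X.carrier) :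
    Hom.map (f ≫ g) x = g.map (f.map x) := rfl

theorem hom_ext {X Y : MdTop.{u}} {f g : X ⟶ Y} (h : ∀ x, f.map x = g.map x) : f = g :=
  Hom.ext (ContinuousMap.ext h)

theorem IsExec.congr {X : MdTop.{u}} {x y x' y' : X.carrier} {γ : Path x y} {γ' : Path x' y'}
    (h : X.IsExec γ) (e : ∀ t, γ' t = γ t) : X.IsExec γ' := by
  have hx : x' = x := by rw [← γ'.source, e, γ.source]
  have hy : y' = y := by rw [← γ'.target, e, γ.target]
  subst hx hy
  rwa [show γ' = γ from Path.ext (funext e)]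

/-- The underlying space functor. -/
def toTop : MdTop.{u} ⥤ TopCat.{u} where
  obj X := TopCat.of X.carrier
  map f := TopCat.ofHom f.map

/-! ### Colimits of multipointed `d`-spaces -/

section Colimits

variable {J : Type u} [Category.{0} J] (F : J ⥤ MdTop.{u})

/-- The execution paths of the colimit: the smallest set of paths that contains the images of the
execution paths and is closed under reparametrization and normalized composition. -/
inductive ColimitExec (c : Cocone (F ⋙ toTop)) : ∀ {x y : c.pt}, Path x y → Prop
  | of (j : J) {x y : (F.obj j).carrier} (γ : Path x y) (h : (F.obj j).IsExec γ) :
      ColimitExec c (γ.map (c.ι.app j).hom.continuous)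
  | reparam {x y : c.pt} (γ : Path x y) (φ : I ≃o I) :
      ColimitExec c γ → ColimitExec c (reparam γ φ)
  | trans {x y z : c.pt} (γ₁ : Path x y) (γ₂ : Path y z) :
      ColimitExec c γ₁ → ColimitExec c γ₂ → ColimitExec c (γ₁.trans γ₂)

/-- The colimit: the colimit of the underlying spaces, the images of the states, and the final set
of execution paths. -/
def colimitPt {c : Cocone (F ⋙ toTop)} (hc : IsColimit c) : MdTop.{u} where
  carrier := c.pt
  deltaGenerated := by
    have h := TopCat.coinduced_of_isColimit c hc
    rw [h]
    exact IsGeneratedBy.iSup fun j ↦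
      IsGeneratedBy.coinduced (tY := (F.obj j).top) (X := fun n : ℕ ↦ Fin n → ℝ) _
  states := {x | ∃ (j : J) (s : (F.obj j).carrier), s ∈ (F.obj j).states ∧ c.ι.app j s = x}
  IsExec := ColimitExec F c
  source_mem h := by
    induction h with
    | of j γ h => exact ⟨j, _, (F.obj j).source_mem h, rfl⟩
    | reparam γ φ _ ih => exact ih
    | trans γ₁ γ₂ _ _ ih₁ ih₂ => exact ih₁
  target_mem h := by
    induction h with
    | of j γ h => exact ⟨j, _, (F.obj j).target_mem h, rfl⟩
    | reparam γ φ _ ih => exact ih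
    | trans γ₁ γ₂ _ _ ih₁ ih₂ => exact ih₂
  reparam_mem φ h := ColimitExec.reparam _ φ h
  trans_mem h₁ h₂ := ColimitExec.trans _ _ h₁ h₂

/-- The colimit cocone. -/
def colimitCocone {c : Cocone (F ⋙ toTop)} (hc : IsColimit c) : Cocone F where
  pt := colimitPt F hc
  ι :=
    { app j :=
        { map := (c.ι.app j).hom
          map_states := fun x hx ↦ ⟨j, x, hx, rfl⟩
          map_exec := fun h ↦ ColimitExec.of j _ h }
      naturality j k f := by
        refine hom_ext fun x ↦ ?_
        exact ConcreteCategory.congr_hom (c.w f) x }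

/-- The colimit cocone is a colimit. -/
def colimitCoconeIsColimit {c : Cocone (F ⋙ toTop)} (hc : IsColimit c) :
    IsColimit (colimitCocone F hc) where
  desc s :=
    { map := (hc.desc (toTop.mapCocone s)).hom
      map_states := by
        rintro _ ⟨j, x, hx, rfl⟩
        have := ConcreteCategory.congr_hom (hc.fac (toTop.mapCocone s) j) x
        exact (congrArg (· ∈ s.pt.states) this).mpr ((s.ι.app j).map_states x hx)
      map_exec := by
        intro x y γ h
        change ColimitExec F c γ at h
        induction h with
        | of j γ h =>
          refine IsExec.congr ((s.ι.app j).map_exec h) fun t ↦ ?_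
          exact ConcreteCategory.congr_hom (hc.fac (toTop.mapCocone s) j) (γ t)
        | reparam γ φ _ ih => exact s.pt.reparam_mem φ ih
        | trans γ₁ γ₂ _ _ ih₁ ih₂ =>
          refine IsExec.congr (s.pt.trans_mem ih₁ ih₂) fun t ↦ ?_
          exact DFunLike.congr_fun (Path.map_trans γ₁ γ₂ (f := (hc.desc (toTop.mapCocone s)).hom)
            (ContinuousMap.continuous _)) t }
  fac s j := hom_ext fun x ↦
    ConcreteCategory.congr_hom (hc.fac (toTop.mapCocone s) j) x
  uniq s m h := by
    refine hom_ext fun x ↦ ?_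
    have := hc.uniq (toTop.mapCocone s) (toTop.map m) (fun j ↦ by
      have := congrArg toTop.map (h j)
      exact this)
    exact ConcreteCategory.congr_hom this x

instance : HasColimitsOfSize.{0, u} MdTop.{u} where
  has_colimits_of_shape _ _ :=
    { has_colimit F := ⟨⟨⟨_, colimitCoconeIsColimit F (colimit.isColimit (F ⋙ toTop))⟩⟩⟩ }

end Colimits

end MdTop

/-! ## The tame regular realization -/

theorem IsRegular.reparam {X : Type*} [TopologicalSpace X] [T1Space X] {x y : X} {γ : Path x y}
    (h : IsRegular γ) (φ : I ≃o I) : IsRegular (reparam γ φ) := by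
  rw [isRegular_iff γ.continuous] at h
  rw [isRegular_iff (Path.continuous _)]
  intro a b hab hc
  refine h (φ a) (φ b) (φ.strictMono hab) fun s hs t ht ↦ ?_
  have := hc (φ.symm s) ⟨(φ.le_symm_apply).2 hs.1, (φ.symm_apply_le).2 hs.2⟩
    (φ.symm t) ⟨(φ.le_symm_apply).2 ht.1, (φ.symm_apply_le).2 ht.2⟩
  simpa using this

theorem IsRegular.trans {X : Type*} [TopologicalSpace X] [T1Space X] {x y z : X} {γ₁ : Path x y}
    {γ₂ : Path y z} (h₁ : IsRegular γ₁) (h₂ : IsRegular γ₂) : IsRegular (γ₁.trans γ₂) := by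
  rw [isRegular_iff (Path.continuous _)] at h₁ h₂ ⊢
  intro a b hab hc
  have hab' : (a : ℝ) < b := hab
  have e : ∀ s : ℝ, s ∈ Set.Icc (a : ℝ) b → ∀ t : ℝ, t ∈ Set.Icc (a : ℝ) b →
      (γ₁.trans γ₂).extend s = (γ₁.trans γ₂).extend t := by
    intro s hs t ht
    have hs' : s ∈ I := ⟨a.2.1.trans hs.1, hs.2.trans b.2.2⟩
    have ht' : t ∈ I := ⟨a.2.1.trans ht.1, ht.2.trans b.2.2⟩
    rw [Path.extend_apply _ hs', Path.extend_apply _ ht']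
    exact hc ⟨s, hs'⟩ hs ⟨t, ht'⟩ ht
  rcases lt_or_ge (a : ℝ) (1 / 2) with h | h
  · let m : ℝ := min b (1 / 2)
    have hm : m ≤ 1 / 2 := min_le_right _ _
    have hmb : m ≤ b := min_le_left _ _
    have ham : (a : ℝ) < m := lt_min hab' h
    have ha0 : (0 : ℝ) ≤ a := a.2.1
    refine h₁ ⟨2 * a, by constructor <;> linarith⟩ ⟨2 * m, by constructor <;> linarith⟩
      (show 2 * (a : ℝ) < 2 * m by linarith) fun s hs t ht ↦ ?_
    have hs1 : 2 * (a : ℝ) ≤ s := hs.1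
    have hs2 : (s : ℝ) ≤ 2 * m := hs.2
    have ht1 : 2 * (a : ℝ) ≤ t := ht.1
    have ht2 : (t : ℝ) ≤ 2 * m := ht.2
    have := e (s / 2) ⟨by linarith, by linarith⟩ (t / 2) ⟨by linarith, by linarith⟩
    rw [Path.extend_trans_of_le_half _ _ (by linarith),
      Path.extend_trans_of_le_half _ _ (by linarith), mul_div_cancel₀ _ two_ne_zero,
      mul_div_cancel₀ _ two_ne_zero, Path.extend_extends', Path.extend_extends'] at this
    exact this
  · have hb1 : (b : ℝ) ≤ 1 := b.2.2
    refine h₂ ⟨2 * a - 1, by constructor <;> linarith⟩ ⟨2 * b - 1, by constructor <;> linarith⟩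
      (show 2 * (a : ℝ) - 1 < 2 * b - 1 by linarith) fun s hs t ht ↦ ?_
    have hs1 : 2 * (a : ℝ) - 1 ≤ s := hs.1
    have hs2 : (s : ℝ) ≤ 2 * b - 1 := hs.2
    have ht1 : 2 * (a : ℝ) - 1 ≤ t := ht.1
    have ht2 : (t : ℝ) ≤ 2 * b - 1 := ht.2
    have := e ((s + 1) / 2) ⟨by linarith, by linarith⟩ ((t + 1) / 2) ⟨by linarith, by linarith⟩
    rw [Path.extend_trans_of_half_le _ _ (by linarith),
      Path.extend_trans_of_half_le _ _ (by linarith), mul_div_cancel₀ _ two_ne_zero,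
      mul_div_cancel₀ _ two_ne_zero, add_sub_cancel_right, add_sub_cancel_right,
      Path.extend_extends', Path.extend_extends'] at this
    exact this

theorem IsRegular.map {X Y : Type*} [TopologicalSpace X] [TopologicalSpace Y] [T1Space X]
    [T1Space Y] {x y : X} {γ : Path x y} (h : IsRegular γ) {f : X → Y} (hf : Continuous f)
    (hi : Function.Injective f) : IsRegular (γ.map hf) := by
  rw [isRegular_iff (Path.continuous _)] at h ⊢
  exact fun a b hab hc ↦ h a b hab fun s hs t ht ↦ hi (hc s hs t ht)

instance t1Space_cube (n : ℕ) : T1Space (ULift.{u} (Fin n → I)) :=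
  Homeomorph.ulift.isEmbedding.t1Space

/-- A `d`-path of the topological cube `[0,1]^n`: nondecreasing with respect to each axis. -/
def IsDPath {n : ℕ} (γ : I → ULift.{u} (Fin n → I)) : Prop := Monotone fun t ↦ (γ t).down

theorem IsDPath.trans {n : ℕ} {x y z : ULift.{u} (Fin n → I)} {γ₁ : Path x y} {γ₂ : Path y z}
    (h₁ : IsDPath γ₁) (h₂ : IsDPath γ₂) : IsDPath (γ₁.trans γ₂) := by
  have e₁ : ∀ t : ℝ, (γ₁.extend t).down ≤ y.down := by
    intro t
    have := h₁ (show Set.projIcc 0 1 zero_le_one t ≤ (1 : I) from unitInterval.le_one _)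
    simp only [Path.target] at this
    exact this
  have e₂ : ∀ t : ℝ, y.down ≤ (γ₂.extend t).down := by
    intro t
    have := h₂ (show (0 : I) ≤ Set.projIcc 0 1 zero_le_one t from unitInterval.nonneg _)
    simp only [Path.source] at this
    exact this
  have m₁ : ∀ s t : ℝ, s ≤ t → (γ₁.extend s).down ≤ (γ₁.extend t).down :=
    fun s t h ↦ h₁ (Set.monotone_projIcc zero_le_one h)
  have m₂ : ∀ s t : ℝ, s ≤ t → (γ₂.extend s).down ≤ (γ₂.extend t).down :=
    fun s t h ↦ h₂ (Set.monotone_projIcc zero_le_one h)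
  intro s t hst
  have hst' : (s : ℝ) ≤ t := hst
  have e : ∀ s : I, (γ₁.trans γ₂) s = (γ₁.trans γ₂).extend s := fun s ↦ by simp
  change ((γ₁.trans γ₂) s).down ≤ ((γ₁.trans γ₂) t).down
  rw [e s, e t]
  rcases le_or_gt (t : ℝ) (1 / 2) with h | h
  · rw [Path.extend_trans_of_le_half _ _ h, Path.extend_trans_of_le_half _ _ (hst'.trans h)]
    exact m₁ _ _ (by linarith)
  · rw [Path.extend_trans_of_half_le _ _ h.le]
    rcases le_or_gt (s : ℝ) (1 / 2) with h' | h'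
    · rw [Path.extend_trans_of_le_half _ _ h']
      exact (e₁ _).trans (e₂ _)
    · rw [Path.extend_trans_of_half_le _ _ h'.le]
      exact m₂ _ _ (by linarith)

/-- The regular `n`-cube: the states are the vertices of `[0,1]^n`, and the execution paths from
`a` to `b` are the regular `d`-paths from `a` to `b` if `a < b`; there are none otherwise. -/
def regularCube (n : ℕ) : MdTop.{u} where
  carrier := ULift.{u} (Fin n → I)
  states := {x | IsVertex x.down}
  IsExec {x y} γ := IsVertex x.down ∧ IsVertex y.down ∧ x.down < y.down ∧ IsDPath γ ∧ IsRegular γ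
  source_mem h := h.1
  target_mem h := h.2.1
  reparam_mem φ h := ⟨h.1, h.2.1, h.2.2.1, h.2.2.2.1.comp φ.monotone, h.2.2.2.2.reparam φ⟩
  trans_mem h₁ h₂ := ⟨h₁.1, h₂.2.1, h₁.2.2.1.trans h₂.2.2.1, h₁.2.2.2.1.trans h₂.2.2.2.1,
    h₁.2.2.2.2.trans h₂.2.2.2.2⟩

theorem IsBoxMap.continuous_up {m n : ℕ} {f : (Fin m → Bool) → (Fin n → Bool)}
    (hf : IsBoxMap f) :
    Continuous fun x : ULift.{u} (Fin m → I) ↦ (ULift.up (cubeMap f x.down) : ULift.{u} _) :=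
  continuous_uliftUp.comp (hf.continuous_cubeMap.comp continuous_uliftDown)

theorem IsBoxMap.isRegular_map {m n : ℕ} {f : (Fin m → Bool) → (Fin n → Bool)}
    (hf : IsBoxMap f) {x y : ULift.{u} (Fin m → I)} (γ : Path x y) (h : IsRegular γ) :
    IsRegular (γ.map hf.continuous_up) :=
  h.map _ fun _ _ e ↦ ULift.down_injective (hf.injective_cubeMap (congrArg ULift.down e))

/-- The cocubical multipointed `d`-space of the regular cubes. -/
def regularCubes : Box ⥤ MdTop.{u} where
  obj b := regularCube b.dim
  map f :=
    { map := ⟨fun x ↦ ULift.up (cubeMap f.1 x.down),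
        f.2.continuous_up⟩
      map_states := fun _ hx ↦ f.2.isVertex_cubeMap hx
      map_exec := fun {_ _ γ} h ↦
        ⟨f.2.isVertex_cubeMap h.1, f.2.isVertex_cubeMap h.2.1,
          (f.2.monotone_cubeMap.strictMono_of_injective f.2.injective_cubeMap) h.2.2.1,
          f.2.monotone_cubeMap.comp h.2.2.2.1,
          f.2.isRegular_map γ h.2.2.2.2⟩ }
  map_id _ := MdTop.hom_ext fun x ↦ congrArg ULift.up (cubeMap_id x.down)
  map_comp f g := MdTop.hom_ext fun x ↦ congrArg ULift.up (cubeMap_comp f.1 g.2 x.down)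

namespace PrecubicalSet

/-- The diagram of the regular cubes over the category of the cubes of `K`. -/
abbrev diagram (K : PrecubicalSet.{u}) : K.Elementsᵒᵖ ⥤ MdTop.{u} :=
  (CategoryOfElements.π K).leftOp ⋙ regularCubes

/-- The canonical map from the regular `n`-cube to the realization given by an `n`-cube of `K`. -/
def cell (K : PrecubicalSet.{u}) {b : Box} (c : K.obj (Opposite.op b)) :
    regularCubes.obj b ⟶ colimit K.diagram :=
  colimit.ι K.diagram (Opposite.op ⟨Opposite.op b, c⟩)

theorem cell_face (K : PrecubicalSet.{u}) {a b : Box} (f : a ⟶ b) (c : K.obj (Opposite.op b)) :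
    regularCubes.map f ≫ K.cell c = K.cell (K.map f.op c) :=
  colimit.w K.diagram
    (Quiver.Hom.op (CategoryOfElements.homMk (F := K) ⟨Opposite.op b, c⟩
      ⟨Opposite.op a, K.map f.op c⟩ f.op rfl))

theorem realization_hom_ext (K : PrecubicalSet.{u}) {Z : MdTop.{u}} {f g : colimit K.diagram ⟶ Z}
    (h : ∀ (b : Box) (c : K.obj (Opposite.op b)), K.cell c ≫ f = K.cell c ≫ g) : f = g :=
  colimit.hom_ext fun j ↦ h j.unop.1.unop j.unop.2

/-- The map induced between the realizations. -/
def realizationMap {K L : PrecubicalSet.{u}} (f : K ⟶ L) :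
    colimit K.diagram ⟶ colimit L.diagram :=
  colimit.desc K.diagram
    { pt := colimit L.diagram
      ι :=
        { app j := L.cell (b := j.unop.1.unop) (f.app _ j.unop.2)
          naturality j k g := by
            have h := L.cell_face g.unop.1.unop (f.app _ k.unop.2)
            have e : L.map g.unop.1 (f.app _ k.unop.2) = f.app _ j.unop.2 := by
              rw [← NatTrans.naturality_apply, g.unop.2]
            refine h.trans ?_
            refine Eq.trans ?_ (Category.comp_id _).symm
            exact congrArg (L.cell (b := j.unop.1.unop)) e } }

@[simp]
theorem cell_realizationMap {K L : PrecubicalSet.{u}} (f : K ⟶ L) {b : Box}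
    (c : K.obj (Opposite.op b)) :
    K.cell c ≫ realizationMap f = L.cell (f.app _ c) :=
  colimit.ι_desc _ _

/-- The tame regular realization `|K|^t_reg`: the colimit over the cubes of `K` of the regular
cubes. -/
def tameRegularRealization : PrecubicalSet.{u} ⥤ MdTop.{u} where
  obj K := colimit K.diagram
  map f := realizationMap f
  map_id K := K.realization_hom_ext fun b c ↦ by simp
  map_comp f g := realization_hom_ext _ fun b c ↦ by
    rw [← Category.assoc, cell_realizationMap, cell_realizationMap, cell_realizationMap]
    rfl

end PrecubicalSet

/-! ## Flows -/

/-- A flow: a small semicategory enriched over `Δ`-generated spaces. It has a set of states, a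
`Δ`-generated space of execution paths for each pair of states, and an associative composition law
that is continuous on the product taken in the category of `Δ`-generated spaces. -/
structure Flow : Type (u + 1) where
  /-- The states. -/
  states : Type u
  /-- The space of execution paths between two states. -/
  path : states → states → Type u
  [top : ∀ α β, TopologicalSpace (path α β)]
  [deltaGenerated : ∀ α β, DeltaGeneratedSpace (path α β)]
  /-- The composition of execution paths. -/
  comp : ∀ {α β γ : states}, path α β → path β γ → path α γ
  comp_continuous : ∀ α β γ : states,
    DeltaContinuous fun p : path α β × path β γ ↦ comp p.1 p.2
  comp_assoc : ∀ {α β γ δ : states} (x : path α β) (y : path β γ) (z : path γ δ),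
    comp (comp x y) z = comp x (comp y z)

namespace Flow

attribute [instance] top deltaGenerated

/-- A map of flows: a map on states and continuous maps on path spaces that respect the
composition. -/
@[ext]
structure Hom (X Y : Flow.{u}) where
  /-- The map on states. -/
  onStates : X.states → Y.states
  /-- The maps on path spaces. -/
  onPaths : ∀ {α β : X.states}, X.path α β → Y.path (onStates α) (onStates β)
  continuous_onPaths : ∀ α β : X.states, Continuous (onPaths (α := α) (β := β))
  onPaths_comp : ∀ {α β γ : X.states} (x : X.path α β) (y : X.path β γ),
    onPaths (X.comp x y) = Y.comp (onPaths x) (onPaths y)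

instance : Category Flow.{u} where
  Hom := Hom
  id X := ⟨fun α ↦ α, fun x ↦ x, fun _ _ ↦ continuous_id, fun _ _ ↦ rfl⟩
  comp f g := ⟨fun α ↦ g.onStates (f.onStates α), fun x ↦ g.onPaths (f.onPaths x),
    fun _ _ ↦ (g.continuous_onPaths _ _).comp (f.continuous_onPaths _ _),
    fun x y ↦ by rw [f.onPaths_comp, g.onPaths_comp]⟩

end Flow

/-! ## The categorization functor -/

namespace MdTop

/-- The space `P^top_{α,β} X` of execution paths from `α` to `β`, with the `Δ`-kelleyfication of
the relative topology induced by the compact-open topology. (Replacing the compact-open topology by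
its `Δ`-kelleyfication does not change the `Δ`-kelleyfication of the relative topology.) -/
abbrev ExecPath (X : MdTop.{u}) (α β : X.states) : Type u :=
  DeltaGeneratedSpace.of (Y := {γ : Path (α : X.carrier) (β : X.carrier) // X.IsExec γ})

namespace ExecPath

variable {X : MdTop.{u}} {α β γ : X.states}

/-- The underlying path. -/
def path (c : X.ExecPath α β) : Path (α : X.carrier) (β : X.carrier) :=
  (WithGeneratedByTopology.equiv c).1

theorem isExec (c : X.ExecPath α β) : X.IsExec c.path := (WithGeneratedByTopology.equiv c).2

/-- Constructor. -/
def mk (p : Path (α : X.carrier) (β : X.carrier)) (h : X.IsExec p) : X.ExecPath α β :=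
  WithGeneratedByTopology.equiv.symm ⟨p, h⟩

@[ext]
theorem ext {c d : X.ExecPath α β} (h : c.path = d.path) : c = d :=
  WithGeneratedByTopology.equiv.injective (Subtype.ext h)

theorem continuous_path : Continuous (path : X.ExecPath α β → _) :=
  continuous_subtype_val.comp WithGeneratedByTopology.continuous_equiv

theorem deltaContinuous_mk {T : Type*} [TopologicalSpace T]
    {f : T → Path (α : X.carrier) (β : X.carrier)} (hf : Continuous f) (h : ∀ t, X.IsExec (f t)) :
    DeltaContinuous fun t ↦ mk (f t) (h t) :=
  ContinuousGeneratedBy.comp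
    (WithGeneratedByTopology.equivSymmAsContinuousMapGeneratedBy (fun n : ℕ ↦ Fin n → ℝ)
      {γ : Path (α : X.carrier) (β : X.carrier) // X.IsExec γ}).prop
    (hf.subtype_mk h).continuousGeneratedBy

end ExecPath

/-- Two execution paths are identified if one is a reparametrization of the other. -/
def reparamSetoid (X : MdTop.{u}) (α β : X.states) : Setoid (X.ExecPath α β) where
  r c d := ∃ φ : I ≃o I, d.path = reparam c.path φ
  iseqv :=
    { refl c := ⟨OrderIso.refl _, rfl⟩
      symm := by
        rintro c d ⟨φ, h⟩
        refine ⟨φ.symm, ?_⟩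
        rw [h]
        ext t
        simp
      trans := by
        rintro c d e ⟨φ, h⟩ ⟨ψ, h'⟩
        exact ⟨ψ.trans φ, by rw [h', h]; rfl⟩ }

/-- The coequalizer `P_{α,β} X` of the maps `(c, φ) ↦ c` and `(c, φ) ↦ c.φ` from
`P^top_{α,β} X × G(1,1)` to `P^top_{α,β} X`: the quotient space of `P^top_{α,β} X` by
reparametrization. -/
abbrev Trace (X : MdTop.{u}) (α β : X.states) : Type u := Quotient (X.reparamSetoid α β)

/-- The composition of `P_{α,β} X`, induced by the normalized composition. -/
def Trace.comp {X : MdTop.{u}} {α β γ : X.states} : X.Trace α β → X.Trace β γ → X.Trace α γ :=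
  Quotient.map₂ (fun c d ↦ ExecPath.mk (c.path.trans d.path) (X.trans_mem c.isExec d.isExec)) (by
    rintro c c' ⟨φ, hφ⟩ d d' ⟨ψ, hψ⟩
    obtain ⟨χ, hχ⟩ := trans_reparam c.path d.path φ ψ
    refine ⟨χ, ?_⟩
    change c'.path.trans d'.path = _
    rw [hφ, hψ, hχ]
    rfl)

/-- The flow `Cat(X)`. -/
def catObj (X : MdTop.{u}) : Flow.{u} where
  states := X.states
  path := X.Trace
  comp := Trace.comp
  comp_continuous α β γ := by
    refine DeltaContinuous.descend (isQuotientMap_quotient_mk' (s := X.reparamSetoid α β))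
      (isQuotientMap_quotient_mk' (s := X.reparamSetoid β γ)) ?_
    refine ContinuousGeneratedBy.comp (Continuous.continuousGeneratedBy
      (isQuotientMap_quotient_mk' (s := X.reparamSetoid α γ)).continuous)
      (ExecPath.deltaContinuous_mk (f := fun p : X.ExecPath α β × X.ExecPath β γ ↦
        p.1.path.trans p.2.path) ?_ fun p ↦ X.trans_mem p.1.isExec p.2.isExec)
    exact Path.continuous_trans.comp ((ExecPath.continuous_path.comp continuous_fst).prodMk
      (ExecPath.continuous_path.comp continuous_snd))
  comp_assoc x y z := by
    induction x using Quotient.inductionOn with | _ x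
    induction y using Quotient.inductionOn with | _ y
    induction z using Quotient.inductionOn with | _ z
    obtain ⟨χ, hχ⟩ := trans_assoc_reparam x.path y.path z.path
    refine (Quotient.sound (s := X.reparamSetoid _ _) ?_).symm
    exact ⟨χ, hχ⟩

/-- The image of an execution path. -/
def ExecPath.map {X Y : MdTop.{u}} (f : X ⟶ Y) {α β : X.states} (c : X.ExecPath α β) :
    Y.ExecPath ⟨f.map α, f.map_states _ α.2⟩ ⟨f.map β, f.map_states _ β.2⟩ :=
  ExecPath.mk (c.path.map f.map.continuous) (f.map_exec c.isExec)

theorem ExecPath.continuous_map {X Y : MdTop.{u}} (f : X ⟶ Y) (α β : X.states) :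
    Continuous (ExecPath.map f : X.ExecPath α β → _) := by
  refine DeltaContinuous.continuous (ExecPath.deltaContinuous_mk ?_ _)
  rw [Path.continuous_uncurry_iff.symm]
  exact f.map.continuous.comp (continuous_eval.comp
    ((ExecPath.continuous_path.comp continuous_fst).prodMk continuous_snd))

/-- The image of the class of an execution path. -/
def Trace.map {X Y : MdTop.{u}} (f : X ⟶ Y) {α β : X.states} :
    X.Trace α β → Y.Trace ⟨f.map α, f.map_states _ α.2⟩ ⟨f.map β, f.map_states _ β.2⟩ :=
  Quotient.map (ExecPath.map f) (by
    rintro c d ⟨φ, h⟩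
    exact ⟨φ, congrArg (fun p ↦ p.map f.map.continuous) h⟩)

theorem Trace.continuous_map {X Y : MdTop.{u}} (f : X ⟶ Y) (α β : X.states) :
    Continuous (Trace.map f : X.Trace α β → _) := by
  refine (isQuotientMap_quotient_mk' (s := X.reparamSetoid α β)).continuous_iff.2 ?_
  exact (isQuotientMap_quotient_mk' (s := Y.reparamSetoid _ _)).continuous.comp
    (ExecPath.continuous_map f α β)

theorem Trace.map_comp {X Y : MdTop.{u}} (f : X ⟶ Y) {α β γ : X.states} (x : X.Trace α β)
    (y : X.Trace β γ) :
    Trace.map f (Trace.comp x y) = Trace.comp (Trace.map f x) (Trace.map f y) := by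
  induction x using Quotient.inductionOn with | _ x
  induction y using Quotient.inductionOn with | _ y
  exact congrArg (Quotient.mk (Y.reparamSetoid _ _))
    (ExecPath.ext (Path.map_trans x.path y.path f.map.continuous))

/-- The categorization functor `Cat` from multipointed `d`-spaces to flows. -/
def cat : MdTop.{u} ⥤ Flow.{u} where
  obj X := X.catObj
  map {X Y} f :=
    { onStates := fun α : X.states ↦ (⟨f.map α, f.map_states _ α.2⟩ : Y.states)
      onPaths := Trace.map f
      continuous_onPaths := Trace.continuous_map f
      onPaths_comp := Trace.map_comp f }
  map_id X := by
    refine Flow.Hom.ext rfl (heq_of_eq ?_)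
    funext α β x
    induction x using Quotient.inductionOn with | _ x
    rfl
  map_comp f g := by
    refine Flow.Hom.ext rfl (heq_of_eq ?_)
    funext α β x
    induction x using Quotient.inductionOn with | _ x
    rfl

end MdTop

/-! ## The tame concrete realization -/

namespace PrecubicalSet

/-- The geometric realization of `K`: the underlying space of `|K|^t_reg`. -/
abbrev Geom (K : PrecubicalSet.{u}) : Type u := (tameRegularRealization.obj K).carrier

/-- The map `|c|_geom : [0,1]^n → |K|_geom` given by an `n`-cube `c` of `K`. -/
def cube (K : PrecubicalSet.{u}) {n : ℕ} (c : K.cubes n) (x : Fin n → I) : K.Geom :=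
  (K.cell c).map (ULift.up x)

/-- The point of `|K|_geom` given by a vertex of `K`. -/
def vertex (K : PrecubicalSet.{u}) (α : K.cubes 0) : K.Geom := K.cube α Fin.elim0

/-- The continuous map `|K|_geom → |L|_geom` given by a map `K → L`. -/
def geomMap {K L : PrecubicalSet.{u}} (f : K ⟶ L) : C(K.Geom, L.Geom) :=
  (tameRegularRealization.map f).map

theorem geomMap_cube {K L : PrecubicalSet.{u}} (f : K ⟶ L) {n : ℕ} (c : K.cubes n)
    (x : Fin n → I) : geomMap f (K.cube c x) = L.cube (f.app _ c) x :=
  congrArg (fun g ↦ MdTop.Hom.map g (ULift.up x)) (cell_realizationMap f c)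

theorem geomMap_id (K : PrecubicalSet.{u}) (x : K.Geom) : geomMap (𝟙 K) x = x := by
  rw [geomMap, CategoryTheory.Functor.map_id]
  rfl

theorem geomMap_comp {K L M : PrecubicalSet.{u}} (f : K ⟶ L) (g : L ⟶ M) (x : K.Geom) :
    geomMap (f ≫ g) x = geomMap g (geomMap f x) := by
  rw [geomMap, CategoryTheory.Functor.map_comp]
  rfl

/-- The relation `HasL1Length K γ a b s`: the restriction of `γ` to `[a,b]` is a `d`-path of `K`,
that is, a Moore composition of paths of the form `[c;δ] = |c|_geom ∘ δ` where `c` is a cube of `K`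
and `δ` is a continuous path in `[0,1]^n` which is nondecreasing with respect to each axis, and `s`
is its `L₁`-arc length, that is, the sum of the `d₁`-distances between the end points of the
paths `δ`. -/
inductive HasL1Length (K : PrecubicalSet.{u}) (γ : ℝ → K.Geom) : ℝ → ℝ → ℝ → Prop
  | cube {a b : ℝ} (hab : a ≤ b) {n : ℕ} (c : K.cubes n) (δ : ℝ → Fin n → I)
      (continuousOn : ContinuousOn δ (Set.Icc a b)) (monotoneOn : MonotoneOn δ (Set.Icc a b))
      (eq : ∀ t ∈ Set.Icc a b, γ t = K.cube c (δ t)) :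
      HasL1Length K γ a b (∑ i, |(δ b i : ℝ) - (δ a i : ℝ)|)
  | concat {a b c s s' : ℝ} :
      HasL1Length K γ a b s → HasL1Length K γ b c s' → HasL1Length K γ a c (s + s')

theorem HasL1Length.le {K : PrecubicalSet.{u}} {γ : ℝ → K.Geom} {a b s : ℝ}
    (h : HasL1Length K γ a b s) : a ≤ b := by
  induction h with
  | cube hab => exact hab
  | concat _ _ ih ih' => exact ih.trans ih'

theorem HasL1Length.congr {K : PrecubicalSet.{u}} {γ γ' : ℝ → K.Geom} {a b s : ℝ}
    (h : HasL1Length K γ a b s) (d : ℝ) (e : ∀ t ∈ Set.Icc a b, γ' (t + d) = γ t) :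
    HasL1Length K γ' (a + d) (b + d) s := by
  induction h with
  | @cube a b hab n c δ hc hm he =>
    have hmap : Set.MapsTo (fun t : ℝ ↦ t - d) (Set.Icc (a + d) (b + d)) (Set.Icc a b) :=
      fun t ht ↦ ⟨by linarith [ht.1], by linarith [ht.2]⟩
    have := HasL1Length.cube (K := K) (γ := γ') (a := a + d) (b := b + d) (by linarith) c
      (fun t ↦ δ (t - d)) (hc.comp (by fun_prop) hmap)
      (fun s hs t ht hst ↦ hm (hmap hs) (hmap ht) (by linarith)) (fun t ht ↦ by
        rw [← he _ (hmap ht), ← e _ (hmap ht), sub_add_cancel])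
    simpa using this
  | concat h h' ih ih' =>
    exact HasL1Length.concat (ih fun t ht ↦ e t ⟨ht.1, ht.2.trans h'.le⟩)
      (ih' fun t ht ↦ e t ⟨h.le.trans ht.1, ht.2⟩)

theorem HasL1Length.map {K L : PrecubicalSet.{u}} (f : K ⟶ L) {γ : ℝ → K.Geom} {a b s : ℝ}
    (h : HasL1Length K γ a b s) : HasL1Length L (fun t ↦ geomMap f (γ t)) a b s := by
  induction h with
  | cube hab c δ hc hm he =>
    exact HasL1Length.cube hab (f.app _ c) δ hc hm fun t ht ↦ by rw [he t ht, geomMap_cube]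
  | concat _ _ ih ih' => exact HasL1Length.concat ih ih'

/-- The set `R^ℓ_{α,β}(K)` of the (nonconstant) tame regular `d`-paths of `K` of length `ℓ` from `α`
to `β`: the paths `t ↦ p (t / ℓ)` for `p` an execution path of `|K|^t_reg` from `α` to `β`. -/
def tameRegularPaths (K : PrecubicalSet.{u}) (ℓ : ℝ) (α β : K.cubes 0) :
    Set C(Set.Icc (0 : ℝ) ℓ, K.Geom) :=
  {γ | ∃ p : Path (K.vertex α) (K.vertex β), (tameRegularRealization.obj K).IsExec p ∧
    ∀ t, γ t = p.extend (t / ℓ)}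

/-- The extension to `ℝ` of a Moore path of length `ℓ`, constant outside `[0,ℓ]`. -/
def extend {X : Type*} [TopologicalSpace X] {n : ℕ+} (γ : C(Set.Icc (0 : ℝ) n, X)) : ℝ → X :=
  Set.IccExtend (Nat.cast_nonneg (n : ℕ)) γ

/-- The natural paths: the tame regular `d`-paths `γ` of `K` of length `n` from `α` to `β` such that
the `L₁`-arc length between `γ 0` and `γ t` is `t` for all `t ∈ [0,n]`. -/
def naturalPaths (K : PrecubicalSet.{u}) (n : ℕ+) (α β : K.cubes 0) :
    Set C(Set.Icc (0 : ℝ) n, K.Geom) :=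
  {γ | γ ∈ K.tameRegularPaths n α β ∧ ∀ t ∈ Set.Icc (0 : ℝ) n, HasL1Length K (extend γ) 0 t t}

/-- The space `N^n_{α,β}(K)` of natural paths, with the `Δ`-kelleyfication of the relative
topology. -/
abbrev NaturalPath (K : PrecubicalSet.{u}) (n : ℕ+) (α β : K.cubes 0) : Type u :=
  DeltaGeneratedSpace.of (Y := K.naturalPaths n α β)

section Extend

variable {X : Type*} [TopologicalSpace X] {m n : ℕ+}

theorem extend_apply (γ : C(Set.Icc (0 : ℝ) n, X)) (t : Set.Icc (0 : ℝ) n) : extend γ t = γ t :=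
  Set.IccExtend_val _ _ _

theorem continuous_extend (γ : C(Set.Icc (0 : ℝ) n, X)) : Continuous (extend γ) :=
  γ.continuous.Icc_extend'

/-- The Moore composition of two paths of length `m` and `n` such that the second one starts where
the first one stops. -/
def mooreComp (γ₁ : C(Set.Icc (0 : ℝ) m, X)) (γ₂ : C(Set.Icc (0 : ℝ) n, X))
    (h : extend γ₁ m = extend γ₂ 0) : C(Set.Icc (0 : ℝ) (m + n : ℕ+), X) where
  toFun t := if (t : ℝ) ≤ m then extend γ₁ t else extend γ₂ (t - m)
  continuous_toFun := by
    refine Continuous.if_le ((continuous_extend γ₁).comp (by fun_prop))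
      ((continuous_extend γ₂).comp (by fun_prop)) (by fun_prop) (by fun_prop) ?_
    intro t ht
    rw [ht, h, sub_self]

theorem extend_mooreComp (γ₁ : C(Set.Icc (0 : ℝ) m, X)) (γ₂ : C(Set.Icc (0 : ℝ) n, X))
    (h : extend γ₁ m = extend γ₂ 0) (t : ℝ) :
    extend (mooreComp γ₁ γ₂ h) t = if t ≤ m then extend γ₁ t else extend γ₂ (t - m) := by
  have hm : (0 : ℝ) < m := Nat.cast_pos.2 m.pos
  have hn : (0 : ℝ) < n := Nat.cast_pos.2 n.pos
  have hmn : ((m + n : ℕ+) : ℝ) = m + n := by push_cast; rfl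
  rcases lt_or_ge t 0 with h0 | h0
  · rw [if_pos (by linarith), extend, Set.IccExtend_of_le_left _ _ h0.le, extend,
      Set.IccExtend_of_le_left _ _ h0.le]
    change (if (0 : ℝ) ≤ m then extend γ₁ 0 else _) = _
    rw [if_pos hm.le]
    exact extend_apply γ₁ ⟨0, _⟩
  · rcases le_or_gt t (m + n) with h1 | h1
    · exact extend_apply (mooreComp γ₁ γ₂ h) ⟨t, h0, by rw [hmn]; exact h1⟩
    · rw [if_neg (by linarith), extend, Set.IccExtend_of_right_le _ _ (by rw [hmn]; exact h1.le),
        extend, Set.IccExtend_of_right_le _ _ (by linarith)]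
      change (if ((m + n : ℕ+) : ℝ) ≤ m then _ else extend γ₂ (((m + n : ℕ+) : ℝ) - m)) = _
      rw [if_neg (by rw [hmn]; linarith), hmn, add_sub_cancel_left]
      exact extend_apply γ₂ ⟨n, _⟩

end Extend

theorem tameRegularPaths_comp {K : PrecubicalSet.{u}} {m n : ℕ+} {α β γ : K.cubes 0}
    {γ₁ : C(Set.Icc (0 : ℝ) m, K.Geom)} {γ₂ : C(Set.Icc (0 : ℝ) n, K.Geom)}
    (h₁ : γ₁ ∈ K.tameRegularPaths m α β) (h₂ : γ₂ ∈ K.tameRegularPaths n β γ)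
    (h : extend γ₁ m = extend γ₂ 0) :
    mooreComp γ₁ γ₂ h ∈ K.tameRegularPaths (m + n : ℕ+) α γ := by
  obtain ⟨p, hp, ep⟩ := h₁
  obtain ⟨q, hq, eq⟩ := h₂
  have hm : (0 : ℝ) < m := Nat.cast_pos.2 m.pos
  have hn : (0 : ℝ) < n := Nat.cast_pos.2 n.pos
  have hmn : ((m + n : ℕ+) : ℝ) = m + n := by push_cast; rfl
  let f : ℝ → ℝ := fun s ↦ if s * (m + n) ≤ m then s * (m + n) / (2 * m)
    else 1 / 2 + (s * (m + n) - m) / (2 * n)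
  have hcont : Continuous f := by
    refine Continuous.if_le (by fun_prop) (by fun_prop) (by fun_prop) (by fun_prop) ?_
    intro s hs
    rw [hs]
    field_simp
    ring
  have hmono : StrictMonoOn f (Set.Icc 0 1) := by
    intro s _ t _ hst
    have hst' : s * (m + n) < t * ((m : ℝ) + n) := mul_lt_mul_of_pos_right hst (by linarith)
    simp only [f]
    split_ifs with hs ht ht
    · gcongr
    · have e1 : s * (m + n) / (2 * (m : ℝ)) ≤ 1 / 2 := by
        rw [div_le_div_iff₀ (by linarith) two_pos]; linarith
      have e2 : 0 < (t * ((m : ℝ) + n) - m) / (2 * n) := div_pos (by linarith) (by linarith)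
      linarith
    · linarith
    · gcongr
  have h0 : f 0 = 0 := by simp [f]
  have h1 : f 1 = 1 := by
    have : ¬ (1 * ((m : ℝ) + n) ≤ m) := by linarith
    simp only [f, if_neg this]
    field_simp
    ring
  refine ⟨reparam (p.trans q) (autOfReal f hcont hmono h0 h1),
    MdTop.reparam_mem _ _ (MdTop.trans_mem _ hp hq), fun t ↦ ?_⟩
  have ht0 : (0 : ℝ) ≤ t := t.2.1
  have ht1 : (t : ℝ) ≤ m + n := t.2.2.trans hmn.le
  have hs : (t : ℝ) / (m + n : ℕ+) ∈ I :=
    ⟨div_nonneg ht0 (Nat.cast_nonneg _), div_le_one_of_le₀ t.2.2 (Nat.cast_nonneg _)⟩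
  rw [Path.extend_apply _ hs, reparam_apply, ← Path.extend_extends', autOfReal_apply]
  have hsc : (t : ℝ) / (m + n : ℕ+) * (m + n) = t := by
    generalize (t : ℝ) = r
    rw [hmn]
    field_simp
  change (if (t : ℝ) ≤ m then extend γ₁ t else extend γ₂ (t - m)) = _
  simp only [f, hsc]
  split_ifs with htm
  · rw [Path.extend_trans_of_le_half _ _ (by
      rw [div_le_div_iff₀ (by linarith) two_pos]; linarith)]
    rw [show extend γ₁ t = _ from (extend_apply γ₁ ⟨t, ht0, htm⟩).trans (ep _)]
    congr 1
    change (t : ℝ) / m = _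
    field_simp
  · have htm' : (m : ℝ) < t := not_le.1 htm
    rw [Path.extend_trans_of_half_le _ _ (by
      have : 0 ≤ ((t : ℝ) - m) / (2 * n) := div_nonneg (by linarith) (by linarith)
      linarith)]
    rw [show extend γ₂ (t - m) = _ from
      (extend_apply γ₂ ⟨t - m, by linarith, by linarith⟩).trans (eq _)]
    congr 1
    change ((t : ℝ) - m) / n = _
    field_simp
    ring

theorem naturalPaths_comp {K : PrecubicalSet.{u}} {m n : ℕ+} {α β γ : K.cubes 0}
    {γ₁ : C(Set.Icc (0 : ℝ) m, K.Geom)} {γ₂ : C(Set.Icc (0 : ℝ) n, K.Geom)}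
    (h₁ : γ₁ ∈ K.naturalPaths m α β) (h₂ : γ₂ ∈ K.naturalPaths n β γ)
    (h : extend γ₁ m = extend γ₂ 0) :
    mooreComp γ₁ γ₂ h ∈ K.naturalPaths (m + n) α γ := by
  refine ⟨tameRegularPaths_comp h₁.1 h₂.1 h, fun t ht ↦ ?_⟩
  have hm : (0 : ℝ) < m := Nat.cast_pos.2 m.pos
  have hmn : ((m + n : ℕ+) : ℝ) = m + n := by push_cast; rfl
  have key : ∀ t ∈ Set.Icc (0 : ℝ) m, HasL1Length K (extend (mooreComp γ₁ γ₂ h)) 0 t t := by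
    intro t ht
    have := (h₁.2 t ht).congr (γ' := extend (mooreComp γ₁ γ₂ h)) 0 fun s hs ↦ by
      rw [add_zero, extend_mooreComp, if_pos (hs.2.trans ht.2)]
    simpa using this
  rcases le_or_gt t m with htm | htm
  · exact key t ⟨ht.1, htm⟩
  · have h3 := (h₂.2 (t - m) ⟨by linarith, by have := ht.2; rw [hmn] at this; linarith⟩).congr
      (γ' := extend (mooreComp γ₁ γ₂ h)) m fun s hs ↦ by
        rw [extend_mooreComp]
        split_ifs with hle
        · have : s = 0 := le_antisymm (by linarith) hs.1
          rw [this, zero_add, h]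
        · rw [add_sub_cancel_right]
    have h4 := (key m ⟨hm.le, le_rfl⟩).concat (by simpa using h3)
    simpa using h4

theorem naturalPaths_source {K : PrecubicalSet.{u}} {n : ℕ+} {α β : K.cubes 0}
    {γ : C(Set.Icc (0 : ℝ) n, K.Geom)} (h : γ ∈ K.naturalPaths n α β) :
    extend γ 0 = K.vertex α := by
  obtain ⟨p, -, hp⟩ := h.1
  rw [show extend γ 0 = _ from (extend_apply γ ⟨0, le_rfl, Nat.cast_nonneg _⟩).trans (hp _)]
  simp

theorem naturalPaths_target {K : PrecubicalSet.{u}} {n : ℕ+} {α β : K.cubes 0}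
    {γ : C(Set.Icc (0 : ℝ) n, K.Geom)} (h : γ ∈ K.naturalPaths n α β) :
    extend γ n = K.vertex β := by
  obtain ⟨p, -, hp⟩ := h.1
  have hn : (n : ℝ) ≠ 0 := Nat.cast_ne_zero.2 n.ne_zero
  rw [show extend γ n = _ from (extend_apply γ ⟨n, Nat.cast_nonneg _, le_rfl⟩).trans (hp _)]
  simp [hn]

theorem naturalPaths_composable {K : PrecubicalSet.{u}} {m n : ℕ+} {α β γ : K.cubes 0}
    {γ₁ : C(Set.Icc (0 : ℝ) m, K.Geom)} {γ₂ : C(Set.Icc (0 : ℝ) n, K.Geom)}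
    (h₁ : γ₁ ∈ K.naturalPaths m α β) (h₂ : γ₂ ∈ K.naturalPaths n β γ) :
    extend γ₁ m = extend γ₂ 0 := by
  rw [naturalPaths_target h₁, naturalPaths_source h₂]

namespace NaturalPath

variable {K : PrecubicalSet.{u}} {m n : ℕ+} {α β γ : K.cubes 0}

/-- The underlying path. -/
def path (c : K.NaturalPath n α β) : C(Set.Icc (0 : ℝ) n, K.Geom) :=
  (WithGeneratedByTopology.equiv c).1

theorem mem (c : K.NaturalPath n α β) : c.path ∈ K.naturalPaths n α β :=
  (WithGeneratedByTopology.equiv c).2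

/-- Constructor. -/
def mk (p : C(Set.Icc (0 : ℝ) n, K.Geom)) (h : p ∈ K.naturalPaths n α β) : K.NaturalPath n α β :=
  WithGeneratedByTopology.equiv.symm ⟨p, h⟩

@[ext]
theorem ext {c d : K.NaturalPath n α β} (h : c.path = d.path) : c = d :=
  WithGeneratedByTopology.equiv.injective (Subtype.ext h)

theorem continuous_path : Continuous (path : K.NaturalPath n α β → _) :=
  continuous_subtype_val.comp WithGeneratedByTopology.continuous_equiv

theorem deltaContinuous_mk {T : Type*} [TopologicalSpace T] {f : T → C(Set.Icc (0 : ℝ) n, K.Geom)}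
    (hf : Continuous f) (h : ∀ t, f t ∈ K.naturalPaths n α β) :
    DeltaContinuous fun t ↦ mk (f t) (h t) :=
  ContinuousGeneratedBy.comp
    (WithGeneratedByTopology.equivSymmAsContinuousMapGeneratedBy (fun n : ℕ ↦ Fin n → ℝ)
      (K.naturalPaths n α β)).prop
    (hf.subtype_mk h).continuousGeneratedBy

/-- The Moore composition of natural paths. -/
def comp (c : K.NaturalPath m α β) (d : K.NaturalPath n β γ) : K.NaturalPath (m + n) α γ :=
  mk (mooreComp c.path d.path (naturalPaths_composable c.mem d.mem))
    (naturalPaths_comp c.mem d.mem _)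

theorem extend_comp (c : K.NaturalPath m α β) (d : K.NaturalPath n β γ) (t : ℝ) :
    extend (c.comp d).path t = if t ≤ m then extend c.path t else extend d.path (t - m) :=
  extend_mooreComp _ _ (naturalPaths_composable c.mem d.mem) t

theorem continuous_extend_path :
    Continuous fun x : K.NaturalPath n α β × ℝ ↦ extend x.1.path x.2 := by
  have : ∀ x : K.NaturalPath n α β × ℝ, extend x.1.path x.2 =
      x.1.path (Set.projIcc 0 (n : ℝ) (Nat.cast_nonneg (n : ℕ)) x.2) := fun _ ↦ rfl
  simp only [this]
  exact continuous_eval.comp ((continuous_path.comp continuous_fst).prodMk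
    ((continuous_projIcc (h := Nat.cast_nonneg (n : ℕ))).comp continuous_snd))

theorem deltaContinuous_comp :
    DeltaContinuous fun x : K.NaturalPath m α β × K.NaturalPath n β γ ↦ comp x.1 x.2 := by
  refine deltaContinuous_mk (ContinuousMap.continuous_of_continuous_uncurry _ ?_) _
  change Continuous fun y : (K.NaturalPath m α β × K.NaturalPath n β γ) ×
    Set.Icc (0 : ℝ) (m + n : ℕ+) ↦ if (y.2 : ℝ) ≤ m then extend y.1.1.path y.2
      else extend y.1.2.path (y.2 - m)
  refine Continuous.if_le
    (continuous_extend_path.comp ((continuous_fst.comp continuous_fst).prodMk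
      (continuous_subtype_val.comp continuous_snd)))
    (continuous_extend_path.comp ((continuous_snd.comp continuous_fst).prodMk
      ((continuous_subtype_val.comp continuous_snd).sub continuous_const)))
    (by fun_prop) (by fun_prop) ?_
  intro y hy
  rw [hy, sub_self]
  exact naturalPaths_composable y.1.1.mem y.1.2.mem

/-- The image of a natural path. -/
def map {K L : PrecubicalSet.{u}} (f : K ⟶ L) {n : ℕ+} {α β : K.cubes 0}
    (c : K.NaturalPath n α β) : L.NaturalPath n (f.app _ α) (f.app _ β) :=
  mk ((geomMap f).comp c.path) (by
    obtain ⟨⟨p, hp, e⟩, h⟩ := c.mem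
    refine ⟨⟨(p.map (geomMap f).continuous).cast (geomMap_cube f α _).symm
      (geomMap_cube f β _).symm, ?_, fun t ↦ ?_⟩, fun t ht ↦ (h t ht).map f⟩
    · exact MdTop.IsExec.congr ((tameRegularRealization.map f).map_exec hp) fun t ↦ rfl
    · exact congrArg (geomMap f) (e t))

theorem continuous_map {K L : PrecubicalSet.{u}} (f : K ⟶ L) {n : ℕ+} {α β : K.cubes 0} :
    Continuous (map f : K.NaturalPath n α β → _) := by
  refine DeltaContinuous.continuous (deltaContinuous_mk ?_ _)
  exact ((geomMap f).continuous_postcomp).comp continuous_path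

end NaturalPath

theorem sigma_ext {K : PrecubicalSet.{u}} {α β : K.cubes 0}
    {x y : Σ n : ℕ+, K.NaturalPath n α β} (h : x.1 = y.1)
    (e : ∀ t, extend x.2.path t = extend y.2.path t) : x = y := by
  obtain ⟨m, x⟩ := x
  obtain ⟨n, y⟩ := y
  obtain rfl : m = n := h
  congr 1
  refine NaturalPath.ext (ContinuousMap.ext fun t ↦ ?_)
  rw [← extend_apply, ← extend_apply]
  exact e t

/-- The composition of natural paths of arbitrary lengths. -/
def sigmaComp {K : PrecubicalSet.{u}} {α β γ : K.cubes 0} (x : Σ n : ℕ+, K.NaturalPath n α β)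
    (y : Σ n : ℕ+, K.NaturalPath n β γ) : Σ n : ℕ+, K.NaturalPath n α γ :=
  ⟨x.1 + y.1, x.2.comp y.2⟩

/-- The tame concrete realization `|K|_tc` of `K`: the states are the vertices of `K`, the space of
execution paths from `α` to `β` is the disjoint sum of the spaces `N^n_{α,β}(K)` for `n ≥ 1`, and
the composition is the Moore composition. -/
def tameConcreteObj (K : PrecubicalSet.{u}) : Flow.{u} where
  states := K.cubes 0
  path α β := Σ n : ℕ+, K.NaturalPath n α β
  comp := sigmaComp
  comp_continuous α β γ := by
    intro k f
    obtain ⟨m, g₁, hg₁, e₁⟩ := (continuous_fst.comp f.continuous).exists_lift_sigma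
    obtain ⟨n, g₂, hg₂, e₂⟩ := (continuous_snd.comp f.continuous).exists_lift_sigma
    have h := NaturalPath.deltaContinuous_comp (K := K) (α := α) (β := β) (γ := γ) (m := m)
      (n := n) ⟨_, hg₁.prodMk hg₂⟩
    have h' : Continuous fun x ↦
        (⟨m + n, (g₁ x).comp (g₂ x)⟩ : Σ n : ℕ+, K.NaturalPath n α γ) :=
      continuous_sigmaMk.comp h
    convert h' using 1
    funext x
    have a₁ : (f x).1 = ⟨m, g₁ x⟩ := congrFun e₁ x
    have a₂ : (f x).2 = ⟨n, g₂ x⟩ := congrFun e₂ x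
    exact congrArg₂ sigmaComp a₁ a₂
  comp_assoc x y z := by
    refine sigma_ext (add_assoc _ _ _) fun t ↦ ?_
    change extend ((x.2.comp y.2).comp z.2).path t = extend (x.2.comp (y.2.comp z.2)).path t
    have hxy : ((x.1 + y.1 : ℕ+) : ℝ) = x.1 + y.1 := by push_cast; rfl
    have hy : (0 : ℝ) < y.1 := Nat.cast_pos.2 y.1.pos
    simp only [NaturalPath.extend_comp, hxy]
    split_ifs
    · rfl
    · rfl
    · linarith
    · linarith
    · exfalso; linarith
    · congr 1; ring

theorem continuous_sigma_map {K L : PrecubicalSet.{u}} (f : K ⟶ L) (α β : K.cubes 0) :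
    Continuous fun x : (Σ n : ℕ+, K.NaturalPath n α β) ↦
      (⟨x.1, x.2.map f⟩ : Σ n : ℕ+, L.NaturalPath n (f.app _ α) (f.app _ β)) :=
  continuous_sigma fun _ ↦ continuous_sigmaMk.comp (NaturalPath.continuous_map f)

theorem map_comp_natural {K L : PrecubicalSet.{u}} (f : K ⟶ L) {m n : ℕ+} {α β γ : K.cubes 0}
    (x : K.NaturalPath m α β) (y : K.NaturalPath n β γ) :
    (x.comp y).map f = (x.map f).comp (y.map f) := by
  refine NaturalPath.ext (ContinuousMap.ext fun t ↦ ?_)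
  exact apply_ite (geomMap f) _ _ _

/-- The tame concrete realization functor. -/
def tameConcreteRealization : PrecubicalSet.{u} ⥤ Flow.{u} where
  obj K := K.tameConcreteObj
  map {K L} f :=
    { onStates := fun α : K.cubes 0 ↦ (f.app _ α : L.cubes 0)
      onPaths := fun x ↦ ⟨x.1, x.2.map f⟩
      continuous_onPaths := continuous_sigma_map f
      onPaths_comp := fun x y ↦ congrArg (Sigma.mk _) (map_comp_natural f x.2 y.2) }
  map_id K := by
    refine Flow.Hom.ext rfl (heq_of_eq ?_)
    funext α β x
    refine sigma_ext rfl fun t ↦ ?_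
    exact geomMap_id K _
  map_comp f g := by
    refine Flow.Hom.ext rfl (heq_of_eq ?_)
    funext α β x
    refine sigma_ext rfl fun t ↦ ?_
    exact geomMap_comp f g _

end PrecubicalSet

end DirectedSpace

end

/-!
The sum of the coordinates of a cube changes by an integer under face maps, so modulo `1` it defines
a continuous phase `|K| → ℝ / ℤ`. The `L₁`-arc length of a `d`-path is the increment of any real
lift of the phase along it; in particular it does not depend on the decomposition of the path.
Along an execution path, regularity makes every nondegenerate subpath have positive length, so the
lift of the phase that starts at `0` increases strictly to an integer `n ≥ 1`. Reparametrizing by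
the inverse of this lift gives the unique natural path in the trace of the execution path, and it
depends continuously on that path since lifts do. Hence the space of traces is homeomorphic to the
sum over `n` of the spaces of natural paths of length `n`.
-/

noncomputable section

namespace DirectedSpace

namespace MdTop

section Colimits

variable {J : Type u} [Category.{0} J] {F : J ⥤ MdTop.{u}}

instance : PreservesColimitsOfSize.{0, u} toTop.{u} where
  preservesColimitsOfShape :=
    { preservesColimit := fun {F} ↦
        preservesColimit_of_preserves_colimit_cocone
          (colimitCoconeIsColimit F (colimit.isColimit (F ⋙ toTop)))
          (IsColimit.ofIsoColimit (colimit.isColimit (F ⋙ toTop)) (Cocone.ext (Iso.refl _))) }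

theorem exists_of_mem_states {c : Cocone F} (hc : IsColimit c) {x : c.pt.carrier}
    (hx : x ∈ c.pt.states) : ∃ (j : J), ∃ s ∈ (F.obj j).states, (c.ι.app j).map s = x := by
  have hd := colimitCoconeIsColimit F (colimit.isColimit (F ⋙ toTop))
  let e := hc.coconePointUniqueUpToIso hd
  obtain ⟨j, s, hs, hsx⟩ := e.hom.map_states x hx
  refine ⟨j, s, hs, ?_⟩
  calc (c.ι.app j).map s = e.inv.map (((colimitCocone F _).ι.app j).map s) :=
        congrArg (fun f ↦ Hom.map f s) (hc.comp_coconePointUniqueUpToIso_inv hd j).symm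
    _ = e.inv.map (e.hom.map x) := congrArg e.inv.map hsx
    _ = x := congrArg (fun f ↦ Hom.map f x) e.hom_inv_id

theorem isExec_induction {c : Cocone F} (hc : IsColimit c)
    {P : ∀ {x y : c.pt.carrier}, Path x y → Prop}
    (of : ∀ (j : J) {x y : (F.obj j).carrier} (γ : Path x y),
      (F.obj j).IsExec γ → P (γ.map (c.ι.app j).map.continuous))
    (reparam : ∀ {x y : c.pt.carrier} (γ : Path x y) (φ : I ≃o I), P γ → P (reparam γ φ))
    (trans : ∀ {x y z : c.pt.carrier} (γ₁ : Path x y) (γ₂ : Path y z),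
      P γ₁ → P γ₂ → P (γ₁.trans γ₂))
    {x y : c.pt.carrier} {γ : Path x y} (h : c.pt.IsExec γ) : P γ := by
  let Z : MdTop.{u} :=
    { carrier := c.pt.carrier
      states := c.pt.states
      IsExec := fun γ ↦ c.pt.IsExec γ ∧ P γ
      source_mem := fun h ↦ c.pt.source_mem h.1
      target_mem := fun h ↦ c.pt.target_mem h.1
      reparam_mem := fun φ h ↦ ⟨c.pt.reparam_mem φ h.1, reparam _ φ h.2⟩
      trans_mem := fun h h' ↦ ⟨c.pt.trans_mem h.1 h'.1, trans _ _ h.2 h'.2⟩ }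
  let ι : Z ⟶ c.pt := ⟨ContinuousMap.id _, fun _ h ↦ h, fun h ↦ h.1⟩
  let s : c.pt ⟶ Z := hc.desc
    { pt := Z
      ι :=
        { app := fun j ↦ ⟨(c.ι.app j).map, (c.ι.app j).map_states,
            fun h ↦ ⟨(c.ι.app j).map_exec h, of j _ h⟩⟩
          naturality := fun j k f ↦ hom_ext fun x ↦
            DFunLike.congr_fun (congrArg Hom.map (c.w f)) x } }
  have hs : s ≫ ι = 𝟙 c.pt := hc.hom_ext fun j ↦ by
    rw [← Category.assoc, hc.fac, Category.comp_id]
    rfl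
  exact (IsExec.congr (X := Z) (s.map_exec h) fun t ↦
    (congrArg (fun g ↦ Hom.map g (γ t)) hs).symm).2

end Colimits

end MdTop

namespace PrecubicalSet

section Desc

variable (K : PrecubicalSet.{u}) {T : Type u} [TopologicalSpace T]
  (g : ∀ b : Box, K.obj (Opposite.op b) → C(Fin b.dim → I, T))
  (hg : ∀ {a b : Box} (f : a ⟶ b) (c : K.obj (Opposite.op b)) (x : Fin a.dim → I),
    g b c (cubeMap f.1 x) = g a (K.map f.op c) x)

/-- The continuous map out of the geometric realization given by a compatible family of continuous
maps out of the topological cubes. -/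
def geomDesc : C(K.Geom, T) :=
  ((isColimitOfPreserves MdTop.toTop (colimit.isColimit K.diagram)).desc
    { pt := TopCat.of T
      ι :=
        { app := fun j ↦ TopCat.ofHom ((g j.unop.1.unop j.unop.2).comp ⟨_, continuous_uliftDown⟩)
          naturality := fun j k f ↦ TopCat.hom_ext <| ContinuousMap.ext fun x ↦
            (hg f.unop.1.unop k.unop.2 x.down).trans
              (congrArg (fun c ↦ g j.unop.1.unop c x.down) f.unop.2) } }).hom

theorem geomDesc_cube {n : ℕ} (c : K.cubes n) (x : Fin n → I) :
    K.geomDesc g hg (K.cube c x) = g ⟨n⟩ c x :=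
  ConcreteCategory.congr_hom
    ((isColimitOfPreserves MdTop.toTop (colimit.isColimit K.diagram)).fac _
      (Opposite.op ⟨Opposite.op ⟨n⟩, c⟩)) (ULift.up x)

end Desc

theorem cube_face (K : PrecubicalSet.{u}) {a b : Box} (f : a ⟶ b) (c : K.obj (Opposite.op b))
    (x : Fin a.dim → I) :
    K.cube (n := b.dim) c (cubeMap f.1 x) = K.cube (n := a.dim) (K.map f.op c) x :=
  congrArg (fun h ↦ MdTop.Hom.map h (ULift.up x)) (K.cell_face f c)

end PrecubicalSet

theorem isBoxMap_const : ∀ {n : ℕ} (ε : Fin n → Bool), IsBoxMap fun _ : Fin 0 → Bool ↦ ε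
  | 0, ε => by
    convert IsBoxMap.id 0 using 2
  | n + 1, ε => by
    convert IsBoxMap.comp (isBoxMap_const (Fin.removeNth 0 ε)) (IsBoxMap.coface 0 (ε 0)) using 2
    exact (Fin.insertNth_self_removeNth 0 ε).symm

/-- The map `[0] → [n]` of the box category given by a vertex of `[n]`. -/
def vertexMap {b : Box} (ε : Fin b.dim → Bool) : (⟨0⟩ : Box) ⟶ b := ⟨fun _ ↦ ε, isBoxMap_const ε⟩

/-- The vertex of `{0,1}^n` with the same coordinates as a vertex of `[0,1]^n`. For any other point
of `[0,1]^n`, the coordinates different from `1` are replaced by `0`. -/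
def toBool {n : ℕ} (x : Fin n → I) (i : Fin n) : Bool := decide (x i = 1)

namespace IsBoxMap

variable {m n : ℕ} {f : (Fin m → Bool) → (Fin n → Bool)}

theorem isVertex_cubeMap_iff (hf : IsBoxMap f) {x : Fin m → I} :
    IsVertex (cubeMap f x) ↔ IsVertex x := by
  refine ⟨fun h j ↦ ?_, hf.isVertex_cubeMap⟩
  obtain ⟨i, hi⟩ := hf.exists_coordinate j
  rw [← cubeMap_of_proj hi x]
  exact h i

theorem toBool_cubeMap (hf : IsBoxMap f) (x : Fin m → I) :
    toBool (cubeMap f x) = f (toBool x) := by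
  funext i
  rcases hf.coordinate i with ⟨b, hb⟩ | ⟨j, hj⟩
  · rw [hb, toBool, cubeMap_of_const hb]; cases b <;> simp
  · rw [hj, toBool, cubeMap_of_proj hj, toBool]

theorem coe_sum_cubeMap (hf : IsBoxMap f) (x : Fin m → I) :
    ((∑ i, (cubeMap f x i : ℝ) : ℝ) : UnitAddCircle) = (∑ j, (x j : ℝ) : ℝ) := by
  induction hf with
  | id n => rw [cubeMap_id]
  | coface k α =>
    rw [cubeMap_coface, Fin.sum_univ_succAbove _ k]
    cases α <;> simp
  | comp _ hg ihf ihg => rw [cubeMap_comp _ hg, ihg, ihf]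

end IsBoxMap

theorem cubeMap_const_toBool {m n : ℕ} {x : Fin n → I} (hx : IsVertex x) (y : Fin m → I) :
    cubeMap (fun _ ↦ toBool x) y = x := by
  funext i
  rw [cubeMap_of_const (b := toBool x i) fun _ ↦ rfl]
  rcases hx i with h | h <;> simp [toBool, h]

namespace PrecubicalSet

variable (K : PrecubicalSet.{u})

theorem cube_of_isVertex {n : ℕ} (c : K.cubes n) {x : Fin n → I} (hx : IsVertex x) :
    K.cube c x = K.vertex (K.map (vertexMap (b := ⟨n⟩) (toBool x)).op c) :=
  (congrArg (K.cube c) (cubeMap_const_toBool hx _)).symm.trans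
    (K.cube_face (vertexMap (b := ⟨n⟩) (toBool x)) c Fin.elim0)

/-- The set of the vertices of `K` that lie at the point `x` of the cube `c`: a singleton if `x` is
a vertex of `[0,1]^n`, and the empty set otherwise. -/
def verticesAt {b : Box} (c : K.obj (Opposite.op b)) (x : Fin b.dim → I) : Set (K.cubes 0) :=
  {α | IsVertex x ∧ K.map (vertexMap (toBool x)).op c = α}

theorem verticesAt_cubeMap {a b : Box} (f : a ⟶ b) (c : K.obj (Opposite.op b))
    (x : Fin a.dim → I) : K.verticesAt c (cubeMap f.1 x) = K.verticesAt (K.map f.op c) x := by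
  have hface : K.map (vertexMap (toBool (cubeMap f.1 x))).op c =
      K.map (vertexMap (toBool x)).op (K.map f.op c) := by
    rw [f.2.toBool_cubeMap]
    exact ConcreteCategory.congr_hom (K.map_comp f.op (vertexMap (toBool x)).op) c
  simp only [verticesAt, hface, f.2.isVertex_cubeMap_iff]

theorem verticesAt_zero (α : K.cubes 0) (x : Fin 0 → I) :
    K.verticesAt (b := ⟨0⟩) α x = {α} := by
  have hid : vertexMap (b := ⟨0⟩) (toBool x) = 𝟙 _ :=
    Subtype.ext (funext fun ε ↦ Subsingleton.elim _ _)
  have hx : IsVertex x := fun i ↦ i.elim0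
  have hmap : K.map (𝟙 (⟨0⟩ : Box)).op α = α := ConcreteCategory.congr_hom (K.map_id _) α
  ext β
  simp only [verticesAt, hid, hmap, hx, true_and, Set.mem_ofPred_eq, Set.mem_singleton_iff,
    eq_comm]

theorem vertex_injective : Function.Injective K.vertex := by
  let : TopologicalSpace (Set (K.cubes 0)) := ⊤
  let d : C(K.Geom, Set (K.cubes 0)) :=
    K.geomDesc (fun b c ↦ ⟨K.verticesAt c, continuous_top⟩) K.verticesAt_cubeMap
  have hd (α : K.cubes 0) : d (K.vertex α) = {α} :=
    (K.geomDesc_cube _ _ α _).trans (K.verticesAt_zero α _)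
  intro α β h
  exact Set.singleton_injective ((hd α).symm.trans ((congrArg d h).trans (hd β)))

/-- The state of `|K|^t_reg` given by a vertex of `K`. -/
abbrev state (α : K.cubes 0) : (tameRegularRealization.obj K).states :=
  ⟨K.vertex α, (K.cell α).map_states _ fun i ↦ i.elim0⟩

theorem state_bijective : Function.Bijective K.state := by
  refine ⟨fun α β h ↦ K.vertex_injective (congrArg Subtype.val h), fun ⟨x, hx⟩ ↦ ?_⟩
  obtain ⟨j, s, hs, rfl⟩ := MdTop.exists_of_mem_states (colimit.isColimit K.diagram) hx
  exact ⟨_, Subtype.ext (K.cube_of_isVertex j.unop.2 hs).symm⟩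

/-- The phase of a point of the geometric realization: the sum modulo `1` of its coordinates in any
cube. The universe lift is forced by the universe of the colimit. -/
def phase (x : K.Geom) : UnitAddCircle :=
  (K.geomDesc (T := ULift.{u} UnitAddCircle)
    (fun _ _ ↦ ⟨fun x ↦ ULift.up ((∑ i, (x i : ℝ) : ℝ) : UnitAddCircle), by fun_prop⟩)
    (fun f _ x ↦ congrArg ULift.up (f.2.coe_sum_cubeMap x)) x).down

theorem continuous_phase : Continuous K.phase :=
  continuous_uliftDown.comp (ContinuousMap.continuous _)

theorem phase_cube {n : ℕ} (c : K.cubes n) (x : Fin n → I) :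
    K.phase (K.cube c x) = (∑ i, (x i : ℝ) : ℝ) :=
  congrArg ULift.down
    (K.geomDesc_cube _ (fun f _ x ↦ congrArg ULift.up (f.2.coe_sum_cubeMap x)) c x)

theorem phase_vertex (α : K.cubes 0) : K.phase (K.vertex α) = 0 := by
  simp only [vertex, phase_cube, Finset.univ_eq_empty, Finset.sum_empty, AddCircle.coe_zero]

end PrecubicalSet

theorem sub_eq_sub_of_coe_eq {Y : Type*} [TopologicalSpace Y] {p : ℝ} {S : Set Y}
    (hS : IsPreconnected S) {F G : Y → ℝ} (hF : ContinuousOn F S) (hG : ContinuousOn G S)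
    (h : ∀ y ∈ S, (F y : AddCircle p) = G y) {a b : Y} (ha : a ∈ S) (hb : b ∈ S) :
    F b - F a = G b - G a := by
  have hadd : S.EqOn F fun y ↦ G y + (F a - G a) := by
    refine (AddCircle.isCoveringMap_coe p).eqOn_of_comp_eqOn hS hF (hG.add continuousOn_const)
      (fun y hy ↦ ?_) ha (add_sub_cancel _ _).symm
    simp only [Function.comp_apply, AddCircle.coe_add, AddCircle.coe_sub, h y hy, h a ha, sub_self,
      add_zero]
  linarith [hadd hb]

theorem IsDPath.strictMono {n : ℕ} {γ : I → ULift.{u} (Fin n → I)} (hd : IsDPath γ)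
    (hγ : Continuous γ) (hr : IsRegular γ) : StrictMono fun t ↦ (γ t).down := by
  refine hd.strictMono_of_injective fun s t hst ↦ ?_
  by_contra hne
  wlog hlt : s < t generalizing s t
  · exact this t s hst.symm (Ne.symm hne) (lt_of_le_of_ne (not_lt.1 hlt) (Ne.symm hne))
  have hconst (r : I) (h : r ∈ Set.Icc s t) : γ r = γ s :=
    ULift.down_injective (le_antisymm ((hd h.2).trans hst.ge) (hd h.1))
  exact (isRegular_iff hγ).1 hr s t hlt fun r h r' h' ↦ (hconst r h).trans (hconst r' h').symm

namespace PrecubicalSet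

variable {K : PrecubicalSet.{u}}

section L1Length

variable {γ γ' : ℝ → K.Geom} {a b m a' b' s : ℝ}

theorem HasL1Length.eq_sub (h : HasL1Length K γ a b s) {F : ℝ → ℝ}
    (hF : ContinuousOn F (Set.Icc a b))
    (hcoe : ∀ t ∈ Set.Icc a b, (F t : UnitAddCircle) = K.phase (γ t)) : s = F b - F a := by
  induction h with
  | @cube a b hab n c δ hδ hmono heq =>
    have ha := Set.left_mem_Icc.2 hab
    have hb := Set.right_mem_Icc.2 hab
    calc ∑ i, |(δ b i : ℝ) - δ a i| = ∑ i, ((δ b i : ℝ) - δ a i) :=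
          Finset.sum_congr rfl fun i _ ↦ abs_of_nonneg (sub_nonneg.2 (hmono ha hb hab i))
      _ = ∑ i, (δ b i : ℝ) - ∑ i, (δ a i : ℝ) := Finset.sum_sub_distrib ..
      _ = F b - F a := sub_eq_sub_of_coe_eq (F := fun t ↦ ∑ i, (δ t i : ℝ)) isPreconnected_Icc
          ((by fun_prop : Continuous fun x : Fin n → I ↦ ∑ i, (x i : ℝ)).comp_continuousOn hδ) hF
          (fun t ht ↦ by rw [hcoe t ht, heq t ht, phase_cube]) ha hb
  | concat h h' ih ih' =>
    rw [ih (hF.mono (Set.Icc_subset_Icc_right h'.le)) fun t ht ↦ hcoe t ⟨ht.1, ht.2.trans h'.le⟩,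
      ih' (hF.mono (Set.Icc_subset_Icc_left h.le)) fun t ht ↦ hcoe t ⟨h.le.trans ht.1, ht.2⟩]
    ring

theorem HasL1Length.comp_monotoneOn (h : HasL1Length K γ a b s) {φ : ℝ → ℝ} (hab : a' ≤ b')
    (hφ : ContinuousOn φ (Set.Icc a' b')) (hm : MonotoneOn φ (Set.Icc a' b'))
    (ha : φ a' = a) (hb : φ b' = b) (e : ∀ t ∈ Set.Icc a' b', γ' t = γ (φ t)) :
    HasL1Length K γ' a' b' s := by
  induction h generalizing a' b' with
  | @cube a b _ n c δ hδ hmono heq =>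
    subst ha hb
    exact cube hab c (δ ∘ φ) (hδ.comp hφ hm.mapsTo_Icc) (hmono.comp hm hm.mapsTo_Icc)
      fun t ht ↦ (e t ht).trans (heq _ (hm.mapsTo_Icc ht))
  | @concat a m b _ _ h h' ih ih' =>
    obtain ⟨m', hm', rfl⟩ := intermediate_value_Icc hab hφ
      (show m ∈ Set.Icc (φ a') (φ b') from ⟨ha ▸ h.le, hb ▸ h'.le⟩)
    have hl : Set.Icc a' m' ⊆ Set.Icc a' b' := Set.Icc_subset_Icc_right hm'.2
    have hr : Set.Icc m' b' ⊆ Set.Icc a' b' := Set.Icc_subset_Icc_left hm'.1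
    exact concat (ih hm'.1 (hφ.mono hl) (hm.mono hl) ha rfl fun t ht ↦ e t (hl ht))
      (ih' hm'.2 (hφ.mono hr) (hm.mono hr) rfl hb fun t ht ↦ e t (hr ht))

/-- The restrictions of `γ` to the nondegenerate subintervals of `[a,b]` are `d`-paths of `K` of
positive `L₁`-arc length. This is the form of regularity that is visible in the realization,
independently of a decomposition of `γ` into paths of the cubes. -/
def HasPosL1Lengths (K : PrecubicalSet.{u}) (γ : ℝ → K.Geom) (a b : ℝ) : Prop :=
  ∀ ⦃s t : ℝ⦄, a ≤ s → s < t → t ≤ b → ∃ ℓ > 0, HasL1Length K γ s t ℓ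

namespace HasPosL1Lengths

theorem cube {n : ℕ} (c : K.cubes n) {δ : ℝ → Fin n → I} (hδ : ContinuousOn δ (Set.Icc a b))
    (hm : StrictMonoOn δ (Set.Icc a b)) (e : ∀ t ∈ Set.Icc a b, γ t = K.cube c (δ t)) :
    HasPosL1Lengths K γ a b := by
  intro s t has hst htb
  have hsub : Set.Icc s t ⊆ Set.Icc a b := Set.Icc_subset_Icc has htb
  refine ⟨_, ?_, .cube hst.le c δ (hδ.mono hsub) (hm.monotoneOn.mono hsub) fun r hr ↦ e r (hsub hr)⟩
  obtain ⟨-, i, hi⟩ := Pi.lt_def.1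
    (hm (hsub (Set.left_mem_Icc.2 hst.le)) (hsub (Set.right_mem_Icc.2 hst.le)) hst)
  exact Finset.sum_pos' (fun _ _ ↦ abs_nonneg _)
    ⟨i, Finset.mem_univ i, abs_pos.2 (sub_pos.2 (Subtype.coe_lt_coe.2 hi)).ne'⟩

theorem comp (h : HasPosL1Lengths K γ a b) {φ : ℝ → ℝ} (hφ : ContinuousOn φ (Set.Icc a' b'))
    (hm : StrictMonoOn φ (Set.Icc a' b')) (hmaps : Set.MapsTo φ (Set.Icc a' b') (Set.Icc a b))
    (e : ∀ t ∈ Set.Icc a' b', γ' t = γ (φ t)) : HasPosL1Lengths K γ' a' b' := by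
  intro s t has hst htb
  have hsub : Set.Icc s t ⊆ Set.Icc a' b' := Set.Icc_subset_Icc has htb
  have hs := hsub (Set.left_mem_Icc.2 hst.le)
  have ht := hsub (Set.right_mem_Icc.2 hst.le)
  obtain ⟨ℓ, hpos, hℓ⟩ := h (hmaps hs).1 (hm hs ht hst) (hmaps ht).2
  exact ⟨ℓ, hpos, hℓ.comp_monotoneOn hst.le (hφ.mono hsub) (hm.monotoneOn.mono hsub) rfl rfl
    fun r hr ↦ e r (hsub hr)⟩

theorem concat (h : HasPosL1Lengths K γ a m) (h' : HasPosL1Lengths K γ m b) :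
    HasPosL1Lengths K γ a b := by
  intro s t has hst htb
  rcases le_or_gt t m with htm | hmt
  · exact h has hst htm
  · rcases le_or_gt m s with hms | hsm
    · exact h' hms hst htb
    · obtain ⟨ℓ, hpos, hℓ⟩ := h has hsm le_rfl
      obtain ⟨ℓ', hpos', hℓ'⟩ := h' le_rfl hmt htb
      exact ⟨ℓ + ℓ', add_pos hpos hpos', hℓ.concat hℓ'⟩

theorem reparam {x y : K.Geom} {p : Path x y} (h : HasPosL1Lengths K p.extend 0 1) (φ : I ≃o I) :
    HasPosL1Lengths K (reparam p φ).extend 0 1 := by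
  have hproj (t : ℝ) : ((φ (Set.projIcc 0 1 zero_le_one t) : I) : ℝ) ∈ Set.Icc (0 : ℝ) 1 :=
    Subtype.prop _
  refine h.comp (φ := fun t ↦ φ (Set.projIcc 0 1 zero_le_one t)) ?_ ?_ (fun t _ ↦ hproj t)
    fun t _ ↦ (Path.extend_apply p (hproj t)).symm
  · exact (continuous_subtype_val.comp (φ.continuous.comp continuous_projIcc)).continuousOn
  · exact fun s hs t ht hst ↦ φ.strictMono (Set.strictMonoOn_projIcc zero_le_one hs ht hst)

theorem trans {x y z : K.Geom} {p : Path x y} {q : Path y z}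
    (hp : HasPosL1Lengths K p.extend 0 1) (hq : HasPosL1Lengths K q.extend 0 1) :
    HasPosL1Lengths K (p.trans q).extend 0 1 := by
  refine concat (m := 1 / 2) (hp.comp (φ := fun t ↦ 2 * t) (by fun_prop) ?_ ?_ ?_)
    (hq.comp (φ := fun t ↦ 2 * t - 1) (by fun_prop) ?_ ?_ ?_)
  · exact fun s _ t _ hst ↦ by dsimp only; linarith
  · exact fun t ht ↦ ⟨by linarith [ht.1], by linarith [ht.2]⟩
  · exact fun t ht ↦ Path.extend_trans_of_le_half _ _ ht.2
  · exact fun s _ t _ hst ↦ by dsimp only; linarith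
  · exact fun t ht ↦ ⟨by linarith [ht.1], by linarith [ht.2]⟩
  · exact fun t ht ↦ Path.extend_trans_of_half_le _ _ ht.1

theorem of_isExec {x y : K.Geom} {p : Path x y} (hp : (tameRegularRealization.obj K).IsExec p) :
    HasPosL1Lengths K p.extend 0 1 := by
  refine MdTop.isExec_induction (colimit.isColimit K.diagram)
    (P := fun p ↦ HasPosL1Lengths K p.extend 0 1) (fun j x y γ h ↦ ?_) (fun _ φ h ↦ h.reparam φ)
    (fun _ _ h h' ↦ h.trans h') hp
  have hmono := h.2.2.2.1.strictMono γ.continuous h.2.2.2.2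
  exact cube (n := j.unop.1.unop.dim) j.unop.2
    (continuous_uliftDown.comp γ.continuous_extend).continuousOn
    (hmono.comp_strictMonoOn (Set.strictMonoOn_projIcc zero_le_one)) fun t _ ↦ rfl

end HasPosL1Lengths

end L1Length

variable {α β : K.cubes 0}

section PhaseLift

variable {y z : K.Geom}

/-- The continuous lift to `ℝ`, starting at `0`, of the phase along a path that starts at a vertex,
extended by constants outside `[0,1]`. Along a `d`-path it is the `L₁`-arc length. -/
def phaseLift (p : Path (K.vertex α) y) : C(ℝ, ℝ) :=
  ((AddCircle.isCoveringMap_coe (1 : ℝ)).liftPath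
    ⟨fun t ↦ K.phase (p t), K.continuous_phase.comp p.continuous⟩ 0
    (by simp [phase_vertex])).IccExtend zero_le_one

theorem coe_phaseLift (p : Path (K.vertex α) y) (t : ℝ) :
    (phaseLift p t : UnitAddCircle) = K.phase (p.extend t) :=
  congrFun ((AddCircle.isCoveringMap_coe (1 : ℝ)).liftPath_lifts _ _ _) (Set.projIcc 0 1 _ t)

@[simp]
theorem phaseLift_zero (p : Path (K.vertex α) y) : phaseLift p 0 = 0 :=
  (Set.IccExtend_left zero_le_one _).trans
    ((AddCircle.isCoveringMap_coe (1 : ℝ)).liftPath_zero _ _ _)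

theorem eq_phaseLift {p : Path (K.vertex α) y} {F : I → ℝ} (hF : Continuous F)
    (hcoe : ∀ t, (F t : UnitAddCircle) = K.phase (p t)) (h0 : F 0 = 0) (t : I) :
    F t = phaseLift p t := by
  have h := sub_eq_sub_of_coe_eq (G := fun t : I ↦ phaseLift p t) isPreconnected_univ
    hF.continuousOn (by fun_prop)
    (fun s _ ↦ by rw [hcoe, coe_phaseLift, Path.extend_extends']) (Set.mem_univ 0) (Set.mem_univ t)
  simpa [h0] using h

theorem phaseLift_reparam (p : Path (K.vertex α) y) (φ : I ≃o I) (t : I) :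
    phaseLift (reparam p φ) t = phaseLift p (φ t) := by
  have hφ := φ.continuous
  refine (eq_phaseLift (F := fun t ↦ phaseLift p (φ t)) (by fun_prop) (fun t ↦ ?_) ?_ t).symm
  · rw [coe_phaseLift, Path.extend_extends', reparam_apply]
  · rw [show φ 0 = 0 from φ.map_bot, Set.Icc.coe_zero, phaseLift_zero]

theorem phaseLift_trans_left (p : Path (K.vertex α) y) (q : Path y z) (t : I) :
    phaseLift (p.trans q) (t / 2) = phaseLift p t := by
  refine eq_phaseLift (F := fun t : I ↦ phaseLift (p.trans q) (t / 2)) (by fun_prop)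
    (fun t ↦ ?_) (by simp) t
  rw [coe_phaseLift, Path.extend_trans_of_le_half _ _ (by linarith [t.2.2]),
    mul_div_cancel₀ _ two_ne_zero, Path.extend_extends']

theorem phaseLift_trans_right (p : Path (K.vertex α) (K.vertex β)) (q : Path (K.vertex β) z)
    (t : I) : phaseLift (p.trans q) ((t + 1) / 2) = phaseLift p 1 + phaseLift q t := by
  rw [← sub_eq_iff_eq_add']
  refine eq_phaseLift (F := fun t : I ↦ phaseLift (p.trans q) ((t + 1) / 2) - phaseLift p 1)
    (by fun_prop) (fun t ↦ ?_) ?_ t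
  · rw [AddCircle.coe_sub, coe_phaseLift, coe_phaseLift, Path.extend_one, phase_vertex, sub_zero,
      Path.extend_trans_of_half_le _ _ (by linarith [t.2.1]), mul_div_cancel₀ _ two_ne_zero,
      add_sub_cancel_right, Path.extend_extends']
  · simpa [sub_eq_zero] using phaseLift_trans_left p q 1

theorem continuous_phaseLift_family {T : Type*} [TopologicalSpace T]
    {f : T → Path (K.vertex α) y} (hf : Continuous f) :
    Continuous fun x : T × I ↦ phaseLift (f x.1) x.2 := by
  have cov := AddCircle.isCoveringMap_coe (1 : ℝ)
  have hphase : Continuous fun x : I × T ↦ K.phase (f x.2 x.1) :=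
    K.continuous_phase.comp (continuous_eval.comp
      ((hf.comp continuous_snd).prodMk continuous_fst))
  have hlift := cov.isLocalHomeomorph.continuous_lift cov.isSeparatedMap ⟨_, hphase⟩
    (g := fun x ↦ phaseLift (f x.2) x.1)
    (funext fun x ↦ by simp only [Function.comp_apply, coe_phaseLift, Path.extend_extends',
      ContinuousMap.coe_mk])
    (by simpa using continuous_const) fun a ↦
      (phaseLift (f a)).continuous.comp continuous_subtype_val
  exact hlift.comp continuous_swap

theorem continuous_phaseLift_apply {T : Type*} [TopologicalSpace T]
    {f : T → Path (K.vertex α) y} (hf : Continuous f) (t : I) :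
    Continuous fun s ↦ phaseLift (f s) t :=
  (continuous_phaseLift_family hf).comp (continuous_id.prodMk continuous_const)

end PhaseLift

section IsExec

variable {x : K.Geom} {p : Path (K.vertex α) x}

theorem strictMonoOn_phaseLift (hp : (tameRegularRealization.obj K).IsExec p) :
    StrictMonoOn (phaseLift p) (Set.Icc 0 1) := by
  intro s hs t ht hst
  obtain ⟨ℓ, hpos, hℓ⟩ := HasPosL1Lengths.of_isExec hp hs.1 hst ht.2
  rw [hℓ.eq_sub (phaseLift p).continuous.continuousOn fun r _ ↦ coe_phaseLift p r] at hpos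
  exact sub_pos.1 hpos

theorem hasL1Length_phaseLift (hp : (tameRegularRealization.obj K).IsExec p) {t : ℝ}
    (ht : t ∈ Set.Icc (0 : ℝ) 1) : HasL1Length K p.extend 0 t (phaseLift p t) := by
  obtain ⟨ℓ, hℓ⟩ : ∃ ℓ, HasL1Length K p.extend 0 t ℓ := by
    rcases ht.1.eq_or_lt with rfl | hpos
    · refine ⟨_, .cube le_rfl α (fun _ ↦ Fin.elim0) continuousOn_const monotoneOn_const ?_⟩
      intro s hs
      rw [le_antisymm hs.2 hs.1, Path.extend_zero, vertex]
    · obtain ⟨ℓ, -, hℓ⟩ := HasPosL1Lengths.of_isExec hp le_rfl hpos ht.2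
      exact ⟨ℓ, hℓ⟩
  have h := hℓ.eq_sub (phaseLift p).continuous.continuousOn fun r _ ↦ coe_phaseLift p r
  rw [phaseLift_zero, sub_zero] at h
  exact h ▸ hℓ

theorem phaseLift_one_pos (hp : (tameRegularRealization.obj K).IsExec p) : 0 < phaseLift p 1 := by
  simpa using strictMonoOn_phaseLift hp (Set.left_mem_Icc.2 zero_le_one)
    (Set.right_mem_Icc.2 zero_le_one) zero_lt_one

theorem exists_phaseLift_one_eq {p : Path (K.vertex α) (K.vertex β)}
    (hp : (tameRegularRealization.obj K).IsExec p) : ∃ n : ℕ+, phaseLift p 1 = n := by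
  have hcoe : (phaseLift p 1 : UnitAddCircle) = 0 := by
    rw [coe_phaseLift, Path.extend_one, phase_vertex]
  obtain ⟨k, hk⟩ := (AddCircle.coe_eq_zero_iff 1).1 hcoe
  rw [zsmul_one] at hk
  have hpos : 0 < k := by exact_mod_cast hk ▸ phaseLift_one_pos hp
  lift k to ℕ using hpos.le
  exact ⟨⟨k, by exact_mod_cast hpos⟩, by simpa using hk.symm⟩

/-- The automorphism of `[0,1]` given by the lift of the phase along an execution path, normalized
by the total length. -/
def phaseAut (hp : (tameRegularRealization.obj K).IsExec p) : I ≃o I :=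
  autOfReal (fun t ↦ phaseLift p t / phaseLift p 1) (by fun_prop)
    (fun _ hs _ ht hst ↦
      div_lt_div_of_pos_right (strictMonoOn_phaseLift hp hs ht hst) (phaseLift_one_pos hp))
    (by simp) (div_self (phaseLift_one_pos hp).ne')

theorem coe_phaseAut (hp : (tameRegularRealization.obj K).IsExec p) (t : I) :
    (phaseAut hp t : ℝ) = phaseLift p t / phaseLift p 1 := rfl

theorem phaseLift_reparam_phaseAut_symm (hp : (tameRegularRealization.obj K).IsExec p) (t : I) :
    phaseLift (reparam p (phaseAut hp).symm) t = phaseLift p 1 * t := by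
  have h := coe_phaseAut hp ((phaseAut hp).symm t)
  rw [OrderIso.apply_symm_apply, eq_div_iff (phaseLift_one_pos hp).ne'] at h
  rw [phaseLift_reparam, ← h, mul_comm]

end IsExec

end PrecubicalSet

theorem mul_mem_Icc {n t : ℝ} (hn : 0 ≤ n) (ht : t ∈ I) : n * t ∈ Set.Icc 0 n :=
  ⟨mul_nonneg hn ht.1, mul_le_of_le_one_right hn ht.2⟩

namespace PrecubicalSet

section Stretch

variable {X : Type*} [TopologicalSpace X] {x y : X}

/-- The Moore path of length `n` obtained by running a path at constant speed. -/
def stretch (n : ℕ+) (p : Path x y) : C(Set.Icc (0 : ℝ) n, X) :=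
  ⟨fun t ↦ p.extend (t / n), by fun_prop⟩

theorem extend_stretch (n : ℕ+) (p : Path x y) {t : ℝ} (ht : t ∈ Set.Icc (0 : ℝ) n) :
    extend (stretch n p) t = p.extend (t / n) :=
  extend_apply _ (⟨t, ht⟩ : Set.Icc (0 : ℝ) n)

end Stretch

variable {K : PrecubicalSet.{u}} {α β γ : K.cubes 0} {m n : ℕ+}

theorem stretch_mem_naturalPaths {p : Path (K.vertex α) (K.vertex β)}
    (hp : (tameRegularRealization.obj K).IsExec p) (hn : ∀ t : I, phaseLift p t = n * t) :
    stretch n p ∈ K.naturalPaths n α β := by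
  refine ⟨⟨p, hp, fun _ ↦ rfl⟩, fun t ht ↦ ?_⟩
  have hpos : (0 : ℝ) < n := Nat.cast_pos.2 n.pos
  have hI : t / n ∈ I := unitInterval.div_mem ht.1 hpos.le ht.2
  have hlen : phaseLift p (t / n) = t :=
    (hn ⟨t / n, hI⟩).trans (mul_div_cancel₀ t hpos.ne')
  have h := hasL1Length_phaseLift hp hI
  rw [hlen] at h
  exact h.comp_monotoneOn (φ := fun t ↦ t / n) ht.1 (by fun_prop)
    (fun r _ s _ hrs ↦ div_le_div_of_nonneg_right hrs hpos.le) (zero_div _) rfl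
    fun r hr ↦ extend_stretch n p ⟨hr.1, hr.2.trans ht.2⟩

namespace NaturalPath

/-- The reparametrization of a natural path by `[0,1]`, at constant speed. -/
def unit (c : K.NaturalPath n α β) : Path (K.vertex α) (K.vertex β) where
  toFun t := extend c.path (n * t)
  continuous_toFun := (continuous_extend _).comp (by fun_prop)
  source' := by simpa using naturalPaths_source c.mem
  target' := by simpa using naturalPaths_target c.mem

theorem unit_apply (c : K.NaturalPath n α β) (t : I) : c.unit t = extend c.path (n * t) := rfl

theorem stretch_unit (c : K.NaturalPath n α β) : stretch n c.unit = c.path := by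
  have hpos : (0 : ℝ) < n := Nat.cast_pos.2 n.pos
  ext t
  calc c.unit.extend (t / n) = extend c.path (n * (t / n)) :=
        Path.extend_apply _ (unitInterval.div_mem t.2.1 hpos.le t.2.2)
    _ = c.path t := by rw [mul_div_cancel₀ _ hpos.ne', extend_apply]

theorem unit_eq_of_path_eq_stretch {c : K.NaturalPath n α β} {p : Path (K.vertex α) (K.vertex β)}
    (h : c.path = stretch n p) : c.unit = p := by
  have hpos : (0 : ℝ) < n := Nat.cast_pos.2 n.pos
  ext t
  rw [unit_apply, h, extend_stretch n p (mul_mem_Icc hpos.le t.2),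
    mul_div_cancel_left₀ _ hpos.ne', Path.extend_extends']

theorem isExec_unit (c : K.NaturalPath n α β) :
    (tameRegularRealization.obj K).IsExec c.unit := by
  obtain ⟨p, hp, hpc⟩ := c.mem.1
  rwa [unit_eq_of_path_eq_stretch (ContinuousMap.ext hpc)]

theorem phaseLift_unit (c : K.NaturalPath n α β) (t : I) : phaseLift c.unit t = n * t := by
  have hpos : (0 : ℝ) < n := Nat.cast_pos.2 n.pos
  have ht := mul_mem_Icc hpos.le t.2
  have h := (c.mem.2 _ ht).eq_sub (F := fun s ↦ phaseLift c.unit (s / n)) (by fun_prop)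
    fun s hs ↦ by
      rw [coe_phaseLift, ← extend_stretch n c.unit ⟨hs.1, hs.2.trans ht.2⟩, stretch_unit]
  rw [mul_div_cancel_left₀ _ hpos.ne', zero_div, phaseLift_zero, sub_zero] at h
  exact h.symm

theorem unit_trans_unit (c : K.NaturalPath m α β) (d : K.NaturalPath n β γ) :
    c.unit.trans d.unit =
      reparam (c.comp d).unit (phaseAut (MdTop.trans_mem _ c.isExec_unit d.isExec_unit)) := by
  have hm : (0 : ℝ) < m := Nat.cast_pos.2 m.pos
  have hn : (0 : ℝ) < n := Nat.cast_pos.2 n.pos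
  have hright (t : I) : phaseLift (c.unit.trans d.unit) ((t + 1) / 2) = m + n * t := by
    rw [phaseLift_trans_right, d.phaseLift_unit, ← Set.Icc.coe_one, c.phaseLift_unit,
      Set.Icc.coe_one, mul_one]
  have hone : phaseLift (c.unit.trans d.unit) 1 = (m + n : ℕ+) := by
    simpa using hright 1
  ext t
  rw [reparam_apply, unit_apply, coe_phaseAut, hone,
    mul_div_cancel₀ _ (Nat.cast_ne_zero.2 (m + n).ne_zero), extend_comp, ← Path.extend_extends']
  rcases le_or_gt (t : ℝ) (1 / 2) with ht | ht
  · let s : I := ⟨2 * t, by linarith [t.2.1], by linarith⟩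
    have hs : (t : ℝ) = s / 2 := (mul_div_cancel_left₀ _ two_ne_zero).symm
    rw [hs, phaseLift_trans_left, c.phaseLift_unit,
      if_pos (mul_le_of_le_one_right hm.le s.2.2), Path.extend_trans_of_le_half _ _ (hs ▸ ht),
      mul_div_cancel₀ _ two_ne_zero, Path.extend_extends', c.unit_apply]
  · let s : I := ⟨2 * t - 1, by linarith, by linarith [t.2.2]⟩
    have hs : (t : ℝ) = (s + 1) / 2 := by dsimp only [s]; ring
    have hpos : 0 < (n : ℝ) * s := mul_pos hn (by dsimp only [s]; linarith)
    rw [hs, hright, if_neg (by linarith), Path.extend_trans_of_half_le _ _ (hs ▸ ht.le),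
      mul_div_cancel₀ _ two_ne_zero, add_sub_cancel_right, add_sub_cancel_left,
      Path.extend_extends', d.unit_apply]

theorem continuous_unit : Continuous (unit : K.NaturalPath n α β → _) := by
  rw [← Path.continuous_uncurry_iff]
  exact continuous_extend_path.comp (continuous_fst.prodMk (by fun_prop))

/-- The execution path given by a natural path. -/
def toExec (c : K.NaturalPath n α β) :
    (tameRegularRealization.obj K).ExecPath (K.state α) (K.state β) :=
  MdTop.ExecPath.mk c.unit c.isExec_unit

theorem continuous_toExec : Continuous (toExec : K.NaturalPath n α β → _) :=
  DeltaContinuous.continuous (MdTop.ExecPath.deltaContinuous_mk continuous_unit _)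

end NaturalPath

/-- The trace of the execution path given by a natural path of arbitrary length. -/
def toTrace (x : Σ n : ℕ+, K.NaturalPath n α β) :
    (tameRegularRealization.obj K).Trace (K.state α) (K.state β) :=
  Quotient.mk _ x.2.toExec

theorem continuous_toTrace : Continuous (toTrace : (Σ n : ℕ+, K.NaturalPath n α β) → _) :=
  continuous_sigma fun _ ↦ (isQuotientMap_quotient_mk'
    (s := MdTop.reparamSetoid _ _ _)).continuous.comp NaturalPath.continuous_toExec

theorem toTrace_injective : Function.Injective (toTrace (K := K) (α := α) (β := β)) := by
  rintro ⟨m, c⟩ ⟨n, d⟩ h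
  obtain ⟨φ, hφ⟩ : ∃ φ, d.unit = reparam c.unit φ :=
    Quotient.exact (s := MdTop.reparamSetoid _ _ _) h
  have hlen (t : I) : (m : ℝ) * φ t = n * t := by
    rw [← c.phaseLift_unit, ← d.phaseLift_unit, hφ, phaseLift_reparam]
  obtain rfl : m = n := by
    have h := hlen 1
    rw [show φ 1 = 1 from φ.map_top] at h
    simpa using h
  have hφt (t : I) : φ t = t :=
    Subtype.ext (mul_left_cancel₀ (Nat.cast_ne_zero.2 m.ne_zero) (hlen t))
  have hunit : d.unit = c.unit := by
    rw [hφ]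
    ext t
    rw [reparam_apply, hφt]
  exact congrArg (Sigma.mk m) (NaturalPath.ext (by
    rw [← c.stretch_unit, ← d.stretch_unit, hunit]))

theorem toTrace_sigmaComp (x : Σ n : ℕ+, K.NaturalPath n α β)
    (y : Σ n : ℕ+, K.NaturalPath n β γ) :
    toTrace (sigmaComp x y) = MdTop.Trace.comp (toTrace x) (toTrace y) :=
  Quotient.sound (s := MdTop.reparamSetoid _ _ _)
    ⟨phaseAut (MdTop.trans_mem _ x.2.isExec_unit y.2.isExec_unit), x.2.unit_trans_unit y.2⟩

end PrecubicalSet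

theorem continuous_orderIso_symm_family {T X Y : Type*} [TopologicalSpace T] [TopologicalSpace X]
    [LinearOrder X] [OrderTopology X] [TopologicalSpace Y] [LinearOrder Y] [OrderClosedTopology Y]
    {φ : T → X ≃o Y} (h : ∀ a, Continuous fun t ↦ φ t a) :
    Continuous fun x : T × Y ↦ (φ x.1).symm x.2 := by
  refine OrderTopology.continuous_iff.2 fun a ↦ ⟨?_, ?_⟩
  · have hpre : (fun x : T × Y ↦ (φ x.1).symm x.2) ⁻¹' Set.Ioi a = {x | φ x.1 a < x.2} := by
      ext x
      exact OrderIso.lt_symm_apply _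
    rw [hpre]
    exact isOpen_lt ((h a).comp continuous_fst) continuous_snd
  · have hpre : (fun x : T × Y ↦ (φ x.1).symm x.2) ⁻¹' Set.Iio a = {x | x.2 < φ x.1 a} := by
      ext x
      exact OrderIso.symm_apply_lt _
    rw [hpre]
    exact isOpen_lt continuous_snd ((h a).comp continuous_fst)

namespace PrecubicalSet

variable {K : PrecubicalSet.{u}} {α β : K.cubes 0}

/-- The natural path that is a reparametrization of a given execution path. The phase lift along
that execution path ends at the integer `n`, which is therefore the length. -/
def naturalize {n : ℕ+} (c : (tameRegularRealization.obj K).ExecPath (K.state α) (K.state β))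
    (hn : phaseLift c.path 1 = n) : K.NaturalPath n α β :=
  NaturalPath.mk (stretch n (reparam c.path (phaseAut c.isExec).symm))
    (stretch_mem_naturalPaths (MdTop.reparam_mem _ _ c.isExec) fun t ↦ by
      rw [phaseLift_reparam_phaseAut_symm, hn])

theorem unit_naturalize {n : ℕ+}
    (c : (tameRegularRealization.obj K).ExecPath (K.state α) (K.state β))
    (hn : phaseLift c.path 1 = n) :
    (naturalize c hn).unit = reparam c.path (phaseAut c.isExec).symm :=
  NaturalPath.unit_eq_of_path_eq_stretch rfl

/-- The natural path, of arbitrary length, that is a reparametrization of a given execution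
path. -/
def ofExec (c : (tameRegularRealization.obj K).ExecPath (K.state α) (K.state β)) :
    Σ n : ℕ+, K.NaturalPath n α β :=
  ⟨_, naturalize c (exists_phaseLift_one_eq c.isExec).choose_spec⟩

theorem ofExec_eq {n : ℕ+} (c : (tameRegularRealization.obj K).ExecPath (K.state α) (K.state β))
    (hn : phaseLift c.path 1 = n) : ofExec c = ⟨n, naturalize c hn⟩ := by
  obtain rfl : n = (exists_phaseLift_one_eq c.isExec).choose := by
    exact_mod_cast hn.symm.trans (exists_phaseLift_one_eq c.isExec).choose_spec
  rfl

theorem toTrace_ofExec (c : (tameRegularRealization.obj K).ExecPath (K.state α) (K.state β)) :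
    toTrace (ofExec c) = Quotient.mk _ c := by
  obtain ⟨n, hn⟩ := exists_phaseLift_one_eq c.isExec
  rw [ofExec_eq c hn]
  exact (Quotient.sound (s := MdTop.reparamSetoid _ _ _) (a := c) (b := (naturalize c hn).toExec)
    ⟨(phaseAut c.isExec).symm, unit_naturalize c hn⟩).symm

section Family

variable {T : Type*} [TopologicalSpace T]
  {f : T → (tameRegularRealization.obj K).ExecPath (K.state α) (K.state β)}

theorem phaseLift_one_eq_of_preconnected [PreconnectedSpace T] (hf : Continuous f) (s t : T) :
    phaseLift (f s).path 1 = phaseLift (f t).path 1 := by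
  have hdiscrete : _root_.IsDiscrete (Set.range ((↑) : ℤ → ℝ)) :=
    Int.isClosedEmbedding_coe_real.isInducing.isDiscrete_range
  have hp : Continuous fun t ↦ (f t).path := MdTop.ExecPath.continuous_path.comp hf
  have hcont : Continuous fun t ↦ phaseLift (f t).path 1 := continuous_phaseLift_apply hp 1
  refine isPreconnected_univ.constant_of_mapsTo hdiscrete hcont.continuousOn (fun t _ ↦ ?_)
    (Set.mem_univ s) (Set.mem_univ t)
  obtain ⟨n, hn⟩ := exists_phaseLift_one_eq (f t).isExec
  exact ⟨n, by simpa using hn.symm⟩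

theorem deltaContinuous_naturalize {n : ℕ+} (hf : Continuous f)
    (hn : ∀ t, phaseLift (f t).path 1 = n) : DeltaContinuous fun t ↦ naturalize (f t) (hn t) := by
  refine NaturalPath.deltaContinuous_mk (ContinuousMap.continuous_of_continuous_uncurry _ ?_) _
  have hp : Continuous fun t ↦ (f t).path := MdTop.ExecPath.continuous_path.comp hf
  have haut (a : I) : Continuous fun t ↦ phaseAut (f t).isExec a := by
    refine continuous_induced_rng.2 ?_
    simp only [Function.comp_def, coe_phaseAut, hn]
    exact (continuous_phaseLift_apply hp a).div_const _
  have hsymm := continuous_orderIso_symm_family haut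
  exact continuous_eval.comp ((hp.comp continuous_fst).prodMk (hsymm.comp
    (continuous_fst.prodMk ((continuous_projIcc (h := zero_le_one)).comp (by fun_prop)))))

end Family

theorem continuous_ofExec : Continuous (ofExec (K := K) (α := α) (β := β)) := by
  refine DeltaContinuous.continuous fun k f ↦ ?_
  obtain ⟨n, hn⟩ := exists_phaseLift_one_eq (f 0).isExec
  have hconst (t : Fin k → ℝ) : phaseLift (f t).path 1 = n :=
    (phaseLift_one_eq_of_preconnected f.continuous t 0).trans hn
  have hof : ofExec ∘ f = fun t ↦ ⟨n, naturalize (f t) (hconst t)⟩ :=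
    funext fun t ↦ ofExec_eq (f t) (hconst t)
  rw [hof]
  exact continuous_sigmaMk.comp
    (DeltaContinuous.continuous (deltaContinuous_naturalize f.continuous hconst))

theorem isHomeomorph_toTrace : IsHomeomorph (toTrace (K := K) (α := α) (β := β)) := by
  let inv : (tameRegularRealization.obj K).Trace (K.state α) (K.state β) →
      Σ n : ℕ+, K.NaturalPath n α β :=
    Quotient.lift ofExec fun c d h ↦ toTrace_injective (by
      rw [toTrace_ofExec, toTrace_ofExec]
      exact Quotient.sound h)
  have hright : Function.RightInverse inv toTrace := Quotient.ind toTrace_ofExec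
  exact isHomeomorph_iff_exists_inverse.2 ⟨continuous_toTrace, inv,
    fun x ↦ toTrace_injective (hright _), hright,
    (isQuotientMap_quotient_mk' (s := MdTop.reparamSetoid _ _ _)).continuous_iff.2
      continuous_ofExec⟩

end PrecubicalSet

namespace Flow

variable {X Y : Flow.{u}}

theorem hom_ext {f g : X ⟶ Y} (hs : ∀ α, f.onStates α = g.onStates α)
    (hp : ∀ {α β : X.states} (x : X.path α β), HEq (f.onPaths x) (g.onPaths x)) : f = g := by
  obtain ⟨fs, fp, fc, fm⟩ := f
  obtain ⟨gs, gp, gc, gm⟩ := g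
  obtain rfl : fs = gs := funext hs
  obtain rfl : @fp = @gp := by
    funext α β x
    exact eq_of_heq (hp x)
  rfl

theorem mono_of_injective (f : X ⟶ Y) (hs : Function.Injective f.onStates)
    (hp : ∀ α β : X.states, Function.Injective (f.onPaths (α := α) (β := β))) : Mono f := by
  have heq_of_heq {α β α' β' : X.states} {x : X.path α β} {x' : X.path α' β'} (hα : α = α')
      (hβ : β = β') (h : HEq (f.onPaths x) (f.onPaths x')) : HEq x x' := by
    subst hα hβ
    exact heq_of_eq (hp _ _ (eq_of_heq h))
  refine ⟨fun {Z} g h hgh ↦ ?_⟩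
  have hstates (α : Z.states) : g.onStates α = h.onStates α :=
    hs (congrArg (fun k : Z ⟶ Y ↦ k.onStates α) hgh)
  refine hom_ext hstates fun {α β} x ↦ heq_of_heq (hstates α) (hstates β) ?_
  change HEq ((g ≫ f).onPaths x) ((h ≫ f).onPaths x)
  rw [hgh]

/-- Transport of the execution paths along equalities of states. -/
def castPath {α β α' β' : Y.states} (hα : α = α') (hβ : β = β') (x : Y.path α β) : Y.path α' β' :=
  hα ▸ hβ ▸ x

theorem castPath_heq {α β α' β' : Y.states} (hα : α = α') (hβ : β = β') (x : Y.path α β) :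
    HEq (castPath hα hβ x) x := by
  subst hα hβ
  rfl

theorem continuous_castPath {α β α' β' : Y.states} (hα : α = α') (hβ : β = β') :
    Continuous (castPath (Y := Y) hα hβ) := by
  subst hα hβ
  exact continuous_id

theorem castPath_comp {α β γ α' β' γ' : Y.states} (hα : α = α') (hβ : β = β') (hγ : γ = γ')
    (x : Y.path α β) (y : Y.path β γ) :
    castPath hα hγ (Y.comp x y) = Y.comp (castPath hα hβ x) (castPath hβ hγ y) := by
  subst hα hβ hγ
  rfl

theorem isIso_of_isHomeomorph (f : X ⟶ Y) (hs : Function.Bijective f.onStates)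
    (hp : ∀ α β : X.states, IsHomeomorph (f.onPaths (α := α) (β := β))) : IsIso f := by
  let e := Equiv.ofBijective f.onStates hs
  let h (α β : X.states) : X.path α β ≃ₜ Y.path (f.onStates α) (f.onStates β) :=
    (hp α β).homeomorph
  have he : ∀ α, f.onStates (e.symm α) = α := e.apply_symm_apply
  have hh {α β : X.states} (y) : f.onPaths ((h α β).symm y) = y := (h α β).apply_symm_apply y
  let g : Y ⟶ X :=
    { onStates := e.symm
      onPaths := fun y ↦ (h _ _).symm (castPath (he _).symm (he _).symm y)
      continuous_onPaths := fun _ _ ↦ (h _ _).symm.continuous.comp (continuous_castPath _ _)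
      onPaths_comp := fun _ _ ↦ (hp _ _).injective (by
        rw [f.onPaths_comp, hh, hh, hh, castPath_comp]) }
  have hgf : g ≫ f = 𝟙 Y := hom_ext he fun _ ↦ (heq_of_eq (hh _)).trans (castPath_heq _ _ _)
  have : Mono f := mono_of_injective f hs.injective fun α β ↦ (hp α β).injective
  have : IsSplitEpi f := .mk' ⟨g, hgf⟩
  exact isIso_of_mono_of_isSplitEpi f

end Flow

theorem MdTop.Trace.mk_heq {X : MdTop.{u}} {α β α' β' : X.states} (hα : α = α') (hβ : β = β')
    {c : X.ExecPath α β} {c' : X.ExecPath α' β'} (h : ∀ t, c.path t = c'.path t) :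
    HEq (Quotient.mk (X.reparamSetoid α β) c) (Quotient.mk (X.reparamSetoid α' β') c') := by
  subst hα hβ
  rw [MdTop.ExecPath.ext (Path.ext (funext h))]

namespace PrecubicalSet

/-- The map of flows from the tame concrete realization to the categorization of the tame regular
realization that sends a natural path to its trace. -/
def comparison (K : PrecubicalSet.{u}) :
    tameConcreteRealization.obj K ⟶ (tameRegularRealization ⋙ MdTop.cat).obj K where
  onStates := K.state
  onPaths := toTrace
  continuous_onPaths _ _ := continuous_toTrace
  onPaths_comp := toTrace_sigmaComp

instance isIso_comparison (K : PrecubicalSet.{u}) : IsIso K.comparison :=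
  Flow.isIso_of_isHomeomorph _ K.state_bijective fun _ _ ↦ isHomeomorph_toTrace

theorem comparison_naturality {K L : PrecubicalSet.{u}} (f : K ⟶ L) :
    tameConcreteRealization.map f ≫ L.comparison =
      K.comparison ≫ (tameRegularRealization ⋙ MdTop.cat).map f := by
  have hs (α : K.cubes 0) : L.state (f.app _ α) =
      ⟨geomMap f (K.vertex α), (tameRegularRealization.map f).map_states _ (K.state α).2⟩ :=
    Subtype.ext (geomMap_cube f α _).symm
  exact Flow.hom_ext hs fun {α β} _ ↦ MdTop.Trace.mk_heq (hs α) (hs β) fun _ ↦ rfl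

end PrecubicalSet

end DirectedSpace

end

theorem mainTheorem9 :
    Nonempty (DirectedSpace.PrecubicalSet.tameRegularRealization.{u} ⋙ DirectedSpace.MdTop.cat.{u} ≅
      DirectedSpace.PrecubicalSet.tameConcreteRealization.{u}) :=
  ⟨(NatIso.ofComponents (fun K ↦ asIso K.comparison)
    DirectedSpace.PrecubicalSet.comparison_naturality).symm⟩
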